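/- Let $A_0$ be a $C^*$-algebra with multiplier algebra $M(A_0)$, let $A_{00}=K(A_0)$ be its Pedersen ideal (the smallest dense two-sided ideal), and let $\Gamma(A_{00})$ be the unital $*$-algebra of multipliers of $A_{00}$, i.e. of pairs $(S,R)$ of linear maps $A_{00}\to A_{00}$ with $R(a)b=aS(b)$ for all $a,b\in A_{00}$. For $T=(S,R)$ and $k\in A_{00}$ write $Tk=S(k)$, $kT=R(k)$; then $T^*k=(k^*T)^*$ and $kT^*=(Tk^*)^*$. Equip $\Gamma(A_{00})$ with the $\kappa$-topology, given by the seminorms $T\mapsto\|Tk\|$ and $T\mapsto\|kT\|$, $k\in A_{00}$. Regard $M(A_0)$ as a subalgebra of $\Gamma(A_{00})$ by restricting multipliers to $A_{00}$. Let $C(\mathbb R)$ be the algebra of continuous functions $\mathbb R\to\mathbb C$ with the compact-open topology, $C_{00}(\mathbb R)$ the subalgebra of compactly supported functions, $C_{00}(-1,1)$ the compactly supported continuous functions on $(-1,1)$ (extended by zero), $\mathrm{id}(t)=t$ and $z(t)=t(1+t^2)^{-1/2}$. A morphism in $\mathrm{Mor}(C(\mathbb R),\Gamma(A_{00}))$ is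 a continuous unital $*$-homomorphism $C(\mathbb R)\to\Gamma(A_{00})$. Let $T\in\Gamma(A_{00})$ be self-adjoint. Then $T$ has a unique $z$-transform: there is exactly one $z_T\in M(A_0)$ with $\|z_T\|\le 1$ such that the closure in $A_0\times A_0$ of $\{(k,Tk):k\in A_{00}\}$ equals $\{((1-z_T^*z_T)^{1/2}a,\;z_Ta):a\in A_0\}$. The element $z_T$ is self-adjoint and $\sigma(z_T)\subseteq[-1,1]$. Assume moreover that $$\mathrm{span}\{f(z_T)a: f\in C_{00}(-1,1),\ a\in A_0\}\supseteq A_{00}.$$ Then there is a unique morphism $\phi_T\in\mathrm{Mor}(C(\mathbb R),\Gamma(A_{00}))$ with $\phi_T(\mathrm{id})=T$. Moreover $\phi_T(z)=z_T$, $\phi_T(f)\in M(A_0)$ for every $f\in C_{00}(\mathbb R)$, and $\phi_T(C_{00}(\mathbb R))A_0\supseteq A_{00}$, i.e. every element of $A_{00}$ is of the form $\phi_T(f)a$ with $f\in C_{00}(\mathbb R)$ and $a\in A_0$. -/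

import Mathlib

open scoped MultiplierAlgebra

noncomputable section

/-- A linear subspace of `A` that is a two-sided ideal (not necessarily closed). -/
def IsTwoSidedAlgIdeal {A : Type*} [NonUnitalCStarAlgebra A] (I : Submodule ℂ A) : Prop :=
  ∀ a : A, ∀ x ∈ I, a * x ∈ I ∧ x * a ∈ I

/-- Pedersen's ideal `K(A)` of a C⋆-algebra: the smallest dense two-sided ideal of `A`,
i.e. the intersection of all dense two-sided ideals. -/
def pedersenIdeal (A : Type*) [NonUnitalCStarAlgebra A] : Submodule ℂ A :=
  sInf {I | IsTwoSidedAlgIdeal I ∧ Dense (I : Set A)}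

theorem star_mem_pedersenIdeal {A : Type*} [NonUnitalCStarAlgebra A] {x : A}
    (hx : x ∈ pedersenIdeal A) : star x ∈ pedersenIdeal A := by
  rw [pedersenIdeal, Submodule.mem_sInf] at hx ⊢
  rintro I ⟨hI, hd⟩
  let J : Submodule ℂ A :=
    { carrier := {y | star y ∈ I}
      add_mem' := by
        intro a b ha hb
        simpa using I.add_mem ha hb
      zero_mem' := by simp
      smul_mem' := by
        intro c y hy
        simpa using I.smul_mem (star c) hy }
  refine hx J ⟨?_, ?_⟩
  · intro a y hy
    have hy' : star y ∈ I := hy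
    refine ⟨?_, ?_⟩
    · change star (a * y) ∈ I
      rw [star_mul]
      exact (hI _ _ hy').2
    · change star (y * a) ∈ I
      rw [star_mul]
      exact (hI _ _ hy').1
  · have : (J : Set A) = star '' (I : Set A) := by
      ext y
      constructor
      · intro hy
        exact ⟨star y, hy, star_star y⟩
      · rintro ⟨w, hw, rfl⟩
        change star (star w) ∈ I
        rwa [star_star]
    rw [this]
    exact star_involutive.surjective.denseRange.dense_image continuous_star hd

/-- The pairs `(S, R)` of linear maps `K(A) → K(A)` with `R(a) b = a S(b)`, as a subalgebra of
`End(K(A)) × End(K(A))ᵒᵖ`; thus `(S, R) (S', R') = (S ∘ S', R' ∘ R)`. -/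
def pedersenMultiplierSubalgebra (A : Type*) [NonUnitalCStarAlgebra A] :
    Subalgebra ℂ (Module.End ℂ (pedersenIdeal A) × (Module.End ℂ (pedersenIdeal A))ᵐᵒᵖ) where
  carrier := {p | ∀ a b : pedersenIdeal A, (p.2.unop a : A) * (b : A) = (a : A) * (p.1 b : A)}
  mul_mem' := by
    intro p p' hp hp' a b
    calc ((p'.2.unop (p.2.unop a) : pedersenIdeal A) : A) * (b : A)
        = (p.2.unop a : A) * (p'.1 b : A) := hp' _ _
      _ = (a : A) * (p.1 (p'.1 b) : A) := hp _ _
  add_mem' := by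
    intro p p' hp hp' a b
    have h := hp a b
    have h' := hp' a b
    simp [add_mul, mul_add, h, h']
  algebraMap_mem' := by
    intro c a b
    simp [Prod.algebraMap_apply, Module.algebraMap_end_apply, smul_mul_assoc, mul_smul_comm]

/-- `Γ(K(A))`, the algebra of (unbounded) multipliers of Pedersen's ideal. -/
def PedersenMultiplier (A : Type*) [NonUnitalCStarAlgebra A] : Type _ :=
  pedersenMultiplierSubalgebra A

namespace PedersenMultiplier

variable {A : Type*} [NonUnitalCStarAlgebra A]

instance : Ring (PedersenMultiplier A) :=
  inferInstanceAs (Ring (pedersenMultiplierSubalgebra A))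

instance : Algebra ℂ (PedersenMultiplier A) :=
  inferInstanceAs (Algebra ℂ (pedersenMultiplierSubalgebra A))

/-- The left action `k ↦ T k` of a multiplier on Pedersen's ideal. -/
def left (T : PedersenMultiplier A) : pedersenIdeal A →ₗ[ℂ] pedersenIdeal A := T.1.1

/-- The right action `k ↦ k T` of a multiplier on Pedersen's ideal. -/
def right (T : PedersenMultiplier A) : pedersenIdeal A →ₗ[ℂ] pedersenIdeal A := T.1.2.unop

theorem central (T : PedersenMultiplier A) (a b : pedersenIdeal A) :
    (T.right a : A) * (b : A) = (a : A) * (T.left b : A) := T.2 a b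

theorem ext' {T T' : PedersenMultiplier A} (hl : ∀ k, T.left k = T'.left k)
    (hr : ∀ k, T.right k = T'.right k) : T = T' :=
  Subtype.ext (Prod.ext (LinearMap.ext hl) (MulOpposite.unop_injective (LinearMap.ext hr)))

/-- The involution of `A`, restricted to Pedersen's ideal. -/
def starK (k : pedersenIdeal A) : pedersenIdeal A := ⟨star (k : A), star_mem_pedersenIdeal k.2⟩

theorem starK_starK (k : pedersenIdeal A) : starK (starK k) = k := Subtype.ext (star_star (k : A))

theorem starK_add (k l : pedersenIdeal A) : starK (k + l) = starK k + starK l :=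
  Subtype.ext (star_add (k : A) (l : A))

theorem starK_smul (c : ℂ) (k : pedersenIdeal A) : starK (c • k) = star c • starK k :=
  Subtype.ext (star_smul c (k : A))

/-- The conjugate `k ↦ (L k⋆)⋆` of a linear map `L` on Pedersen's ideal. -/
def starConj (L : pedersenIdeal A →ₗ[ℂ] pedersenIdeal A) :
    pedersenIdeal A →ₗ[ℂ] pedersenIdeal A where
  toFun k := starK (L (starK k))
  map_add' a b := by rw [starK_add, map_add, starK_add]
  map_smul' c a := by rw [starK_smul, map_smul, starK_smul, star_star, RingHom.id_apply]

/-- The involution of `Γ(K(A))`: `T⋆ k = (k⋆ T)⋆` and `k T⋆ = (T k⋆)⋆`. -/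
instance : Star (PedersenMultiplier A) where
  star T := ⟨(starConj T.right, MulOpposite.op (starConj T.left)), by
    intro a b
    have h := congrArg star (T.central (starK b) (starK a))
    rw [star_mul, star_mul] at h
    change star (T.left (starK a) : A) * (b : A) = (a : A) * star (T.right (starK b) : A)
    have ha : star (starK a : A) = (a : A) := star_star _
    have hb : star (starK b : A) = (b : A) := star_star _
    rw [ha, hb] at h
    exact h.symm⟩

theorem left_star (T : PedersenMultiplier A) (k : pedersenIdeal A) :
    (star T).left k = starK (T.right (starK k)) := rfl

theorem right_star (T : PedersenMultiplier A) (k : pedersenIdeal A) :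
    (star T).right k = starK (T.left (starK k)) := rfl

theorem left_mul (S T : PedersenMultiplier A) (k : pedersenIdeal A) :
    (S * T).left k = S.left (T.left k) := rfl

theorem right_mul (S T : PedersenMultiplier A) (k : pedersenIdeal A) :
    (S * T).right k = T.right (S.right k) := rfl

theorem left_add (S T : PedersenMultiplier A) (k : pedersenIdeal A) :
    (S + T).left k = S.left k + T.left k := rfl

theorem right_add (S T : PedersenMultiplier A) (k : pedersenIdeal A) :
    (S + T).right k = S.right k + T.right k := rfl

instance : StarRing (PedersenMultiplier A) where
  star_involutive T := ext' (fun k => by rw [left_star, right_star, starK_starK, starK_starK])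
    (fun k => by rw [right_star, left_star, starK_starK, starK_starK])
  star_mul S T := ext'
    (fun k => by simp only [left_star, left_mul, right_mul, starK_starK])
    (fun k => by simp only [right_star, left_mul, right_mul, starK_starK])
  star_add S T := ext'
    (fun k => by simp only [left_star, left_add, right_add, starK_add])
    (fun k => by simp only [right_star, left_add, right_add, starK_add])

/-- The `κ`-topology of `Γ(K(A))`, given by the seminorms `T ↦ ‖T k‖` and `T ↦ ‖k T‖` for
`k ∈ K(A)`: pointwise norm convergence of the left and of the right action. -/
instance : TopologicalSpace (PedersenMultiplier A) :=
  TopologicalSpace.induced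
    (fun T => ((fun k => (T.left k : A), fun k => (T.right k : A)) :
      (pedersenIdeal A → A) × (pedersenIdeal A → A)))
    inferInstance

/-- The multiplier `T` of `K(A)` is (the restriction to `K(A)` of) the multiplier `m` of `A`;
this is the identification of `M(A)` with the bounded elements of `Γ(K(A))`. -/
def IsRestrictionOf (T : PedersenMultiplier A) (m : 𝓜(ℂ, A)) : Prop :=
  ∀ k : pedersenIdeal A, (T.left k : A) = m.fst (k : A) ∧ (T.right k : A) = m.snd (k : A)

/-- The graph of `T`, seen as a closed operator on `A` with core `K(A)`: the closure in `A × A` of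
`{(k, T k) : k ∈ K(A)}`. -/
def closedGraph (T : PedersenMultiplier A) : Set (A × A) :=
  closure (Set.range fun k : pedersenIdeal A => ((k : A), (T.left k : A)))

/-- `z ∈ M(A)` is the `z`-transform of the operator `T` in the sense of Woronowicz: `‖z‖ ≤ 1`, and
`x ∈ D(T)`, `y = T x` if and only if `x = (1 - z⋆z)^{1/2} a`, `y = z a` for some `a ∈ A`. -/
def IsZTransform (T : PedersenMultiplier A) (z : 𝓜(ℂ, A)) : Prop :=
  ‖z‖ ≤ 1 ∧
    T.closedGraph = Set.range fun a : A => ((cfc Real.sqrt (1 - star z * z)).fst a, z.fst a)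

end PedersenMultiplier

/-- `f(z)`, by continuous functional calculus, for a self-adjoint `z` in the multiplier algebra and
a function `f : ℝ → ℂ` (on the spectrum of `z`, `w = w.re`). -/
def cfcReal {A : Type*} [NonUnitalCStarAlgebra A] (f : ℝ → ℂ) (z : 𝓜(ℂ, A)) : 𝓜(ℂ, A) :=
  cfc (fun w : ℂ => f w.re) z

/-- The identity function of the line, as an element of `C(ℝ)`. -/
def idFun : C(ℝ, ℂ) := ⟨fun t => (t : ℂ), Complex.continuous_ofReal⟩

/-- The function `t ↦ t (1 + t²)^{-1/2}` as an element of `C(ℝ)`. -/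
def zFun : C(ℝ, ℂ) :=
  ⟨fun t => ((t / Real.sqrt (1 + t ^ 2) : ℝ) : ℂ), by
    refine Complex.continuous_ofReal.comp (continuous_id.div (by fun_prop) fun t => ?_)
    positivity⟩

end

/-!
Let `K` be Pedersen's ideal of `A`. Every `c` with `c * e = c` for some `e : A` lies in each dense
two-sided ideal `I`: if `x ∈ I` is close to `e`, then `1 - (e - x)` is invertible in the unitization
and `c * (1 - (e - x)) = c * x`. The products `l * z` with `l * e = l` span a two-sided ideal, which
is dense because of soft thresholding in the functional calculus of self-adjoint elements. Hence `K`
is dense and is spanned by these products (`pedersenIdeal_eq_rightUnitSpan`).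

This makes multipliers of `K` locally bounded. For each `e : A` the closed left ideal
`rightUnitIdeal e = {l | l * e = l}` is contained in `K` and is invariant under the left action of
every multiplier `T`, which is bounded there by the closed graph theorem. If `T` is self-adjoint, its
restriction is symmetric for the `A`-valued inner product `star x * y`, and the spectral radius
formula bounds `p(T)` on `rightUnitIdeal e` by the supremum of the polynomial `p` over a compact
interval (`IsStarAdjointPair.norm_aeval_le`). Therefore, whenever polynomials converge to
`f : C(ℝ, ℂ)` uniformly on compact sets, their values at `T` converge in the `κ`-topology
(`exists_tendsto_aeval`). The limits form the unique continuous functional calculus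
`calculus : C(ℝ, ℂ) →⋆ₐ[ℂ] PedersenMultiplier A` with `idFun ↦ T`. Its existence does not depend on
the spanning condition.

If `|f| ≤ M`, then `f(T)` has norm at most `M`, because `star f * f + star g * g = M ^ 2` for some
`g`; so `f(T)` extends to a multiplier of `A` (`boundedCalculus`). The `z`-transform is the value at
`t ↦ t (1 + t²)^{-1/2}`, and `(1 - z⋆z)^{1/2}` is the value `w` at `t ↦ (1 + t²)^{-1/2}`. Each `k ∈ K`
is `w a` with `a = (1 + T²)^{1/2} k ∈ K`, and then `T k = z a`; conversely `T (w a) = z a` for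
`a ∈ K`. As `a ↦ (w a, z a)` preserves inner products, its range is the closed graph of `T`.

Bounded functions of `z` are functions of `T` (`isRestrictionOf_cfcReal`), and an element of the
span of the `f(z) a` is fixed by `h(z)` when `h` is a trapezoidal function equal to `1` on the
supports of the functions `f` involved; the composition of `h` with `t ↦ t (1 + t²)^{-1/2}` is
compactly supported. This gives the last claim.
-/

open Filter Topology

/-! ### Pedersen's ideal and its multipliers -/

section PedersenIdeal

variable {A : Type*} [NonUnitalCStarAlgebra A]

theorem isTwoSidedAlgIdeal_pedersenIdeal : IsTwoSidedAlgIdeal (pedersenIdeal A) := by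
  intro a x hx
  rw [pedersenIdeal, Submodule.mem_sInf] at hx
  simp only [pedersenIdeal, Submodule.mem_sInf]
  exact ⟨fun I hI => (hI.1 a x (hx I hI)).1, fun I hI => (hI.1 a x (hx I hI)).2⟩

theorem mul_mem_pedersenIdeal_right (a : A) {x : A} (hx : x ∈ pedersenIdeal A) :
    x * a ∈ pedersenIdeal A :=
  (isTwoSidedAlgIdeal_pedersenIdeal a x hx).2

/-- An element with a right unit belongs to Pedersen's ideal. If `x` in a dense ideal is
close to the right unit `e` of `c`, then `1 - (e - x)` is invertible in the unitization and
`c * (1 - (e - x)) = c * x`. -/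
theorem mem_pedersenIdeal_of_mul_eq {c e : A} (h : c * e = c) : c ∈ pedersenIdeal A := by
  rw [pedersenIdeal, Submodule.mem_sInf]
  rintro I ⟨hI, hd⟩
  obtain ⟨x, hxI, hx⟩ := Metric.mem_closure_iff.mp (hd e) 1 one_pos
  have hn : ‖((e - x : A) : Unitization ℂ A)‖ < 1 := by
    rwa [Unitization.norm_inr, ← dist_eq_norm]
  set u := Units.oneSub ((e - x : A) : Unitization ℂ A) hn with hu
  have h1 : (c : Unitization ℂ A) * u = ((c * x : A) : Unitization ℂ A) := by
    rw [hu, Units.val_oneSub, mul_sub, mul_one, ← Unitization.inr_mul, mul_sub, h]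
    simp
  have h2 : (c : Unitization ℂ A) = ((c * x : A) : Unitization ℂ A) * (↑u⁻¹ : Unitization ℂ A) := by
    rw [← h1, mul_assoc, Units.mul_inv, mul_one]
  have h3 : c = (↑u⁻¹ : Unitization ℂ A).fst • (c * x) + c * x * (↑u⁻¹ : Unitization ℂ A).snd := by
    have := congrArg (fun v : Unitization ℂ A => v.snd) h2
    simpa using this
  rw [h3]
  exact I.add_mem (I.smul_mem _ (hI _ _ hxI).1) (hI _ _ (hI _ _ hxI).1).2

/-- Every self-adjoint element is a limit of elements `b` with a right unit `g`, which
moreover satisfy `b = b * g`; both are functions of the given element. -/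
theorem exists_near_mul_eq {a : A} (ha : IsSelfAdjoint a) {ε : ℝ} (hε : 0 < ε) :
    ∃ b g : A, b * g = b ∧ ‖a - b‖ ≤ ε := by
  -- soft thresholding at height `ε`, and a function equal to `1` where it does not vanish
  let f : ℝ → ℝ := fun t => t - max (-ε) (min t ε)
  let g : ℝ → ℝ := fun t => min 1 (|t| / ε)
  have hf : Continuous f := by fun_prop
  have hg : Continuous g := by fun_prop
  have hf0 : f 0 = 0 := by simp [f, hε.le]
  have hg0 : g 0 = 0 := by simp [g]
  have hfg : ∀ t, f t * g t = f t := by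
    intro t
    by_cases h : |t| ≤ ε
    · have : f t = 0 := by
        rw [abs_le] at h
        simp [f, h.1, h.2]
      simp [this]
    · have : g t = 1 := by
        rw [not_le] at h
        exact min_eq_left (by rw [le_div_iff₀ hε]; linarith)
      simp [this]
  refine ⟨cfcₙ f a, cfcₙ g a, ?_, ?_⟩
  · rw [← cfcₙ_mul f g a hf.continuousOn hf0 hg.continuousOn hg0]
    simp only [hfg]
  · have h1 : a - cfcₙ f a = cfcₙ (fun t => t - f t) a := by
      rw [cfcₙ_sub (fun t : ℝ => t) f a, cfcₙ_id' ℝ a]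
    rw [h1]
    refine norm_cfcₙ_le fun t _ => ?_
    simp only [f, sub_sub_cancel, Real.norm_eq_abs, abs_le]
    exact ⟨le_max_left _ _, max_le (by linarith) (min_le_right _ _)⟩

/-- The span of the products `l * z` where `l` has a right unit. -/
def rightUnitSpan (A : Type*) [NonUnitalCStarAlgebra A] : Submodule ℂ A :=
  Submodule.span ℂ {x | ∃ l e z : A, l * e = l ∧ x = l * z}

theorem isTwoSidedAlgIdeal_rightUnitSpan : IsTwoSidedAlgIdeal (rightUnitSpan A) := by
  intro a x hx
  induction hx using Submodule.span_induction with
  | mem x h =>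
    obtain ⟨l, e, z, h, rfl⟩ := h
    exact ⟨Submodule.subset_span ⟨a * l, e, z, by rw [mul_assoc, h], by rw [mul_assoc]⟩,
      Submodule.subset_span ⟨l, e, z * a, h, by rw [mul_assoc]⟩⟩
  | zero => simp
  | add x y _ _ hx hy =>
    rw [mul_add, add_mul]
    exact ⟨add_mem hx.1 hy.1, add_mem hx.2 hy.2⟩
  | smul c x _ hx =>
    rw [mul_smul_comm, smul_mul_assoc]
    exact ⟨Submodule.smul_mem _ _ hx.1, Submodule.smul_mem _ _ hx.2⟩

theorem dense_rightUnitSpan : Dense (rightUnitSpan A : Set A) := by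
  have hsa : ∀ a : A, IsSelfAdjoint a → a ∈ (rightUnitSpan A).topologicalClosure := by
    intro a ha
    refine Metric.mem_closure_iff.mpr fun ε hε => ?_
    obtain ⟨b, g, hbg, hb⟩ := exists_near_mul_eq ha (half_pos hε)
    refine ⟨b, Submodule.subset_span ⟨b, g, g, hbg, hbg.symm⟩, ?_⟩
    rw [dist_eq_norm]
    linarith
  intro x
  have hx : x ∈ (rightUnitSpan A).topologicalClosure := by
    rw [← realPart_add_I_smul_imaginaryPart x]
    exact add_mem (hsa _ (realPart x).2) (Submodule.smul_mem _ _ (hsa _ (imaginaryPart x).2))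
  exact hx

theorem pedersenIdeal_eq_rightUnitSpan : pedersenIdeal A = rightUnitSpan A := by
  refine le_antisymm (sInf_le ⟨isTwoSidedAlgIdeal_rightUnitSpan, dense_rightUnitSpan⟩) ?_
  refine Submodule.span_le.mpr ?_
  rintro x ⟨l, e, z, h, rfl⟩
  exact mul_mem_pedersenIdeal_right z (mem_pedersenIdeal_of_mul_eq h)

theorem dense_pedersenIdeal : Dense (pedersenIdeal A : Set A) :=
  pedersenIdeal_eq_rightUnitSpan (A := A) ▸ dense_rightUnitSpan

theorem eq_of_pedersenIdeal_mul_eq {x y : A} (h : ∀ a ∈ pedersenIdeal A, a * x = a * y) :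
    x = y := by
  have h1 : ∀ a : A, a * x = a * y := fun a =>
    congrFun (Continuous.ext_on dense_pedersenIdeal (continuous_mul_const x)
      (continuous_mul_const y) h) a
  have h2 : star (x - y) * (x - y) = 0 := by rw [mul_sub, h1, sub_self]
  rwa [CStarRing.star_mul_self_eq_zero_iff, sub_eq_zero] at h2

theorem eq_of_mul_pedersenIdeal_eq {x y : A} (h : ∀ a ∈ pedersenIdeal A, x * a = y * a) :
    x = y := by
  refine star_injective (eq_of_pedersenIdeal_mul_eq fun a ha => star_injective ?_)
  simpa using h (star a) (star_mem_pedersenIdeal ha)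

end PedersenIdeal

namespace PedersenMultiplier

variable {A : Type*} [NonUnitalCStarAlgebra A]

theorem left_mul_right (T : PedersenMultiplier A) (k : pedersenIdeal A) (b : A) :
    (T.left ⟨k * b, mul_mem_pedersenIdeal_right b k.2⟩ : A) = T.left k * b :=
  eq_of_pedersenIdeal_mul_eq fun a ha => by
    rw [← mul_assoc, ← T.central ⟨a, ha⟩ k, ← T.central ⟨a, ha⟩, mul_assoc]

theorem star_left_mul (T : PedersenMultiplier A) (k l : pedersenIdeal A) :
    star (T.left k : A) * l = star (k : A) * (star T).left l := by
  have h := (star T).central (starK k) l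
  rw [right_star, starK_starK] at h
  exact h

theorem left_one (k : pedersenIdeal A) : (1 : PedersenMultiplier A).left k = k := rfl
theorem left_sub (S T : PedersenMultiplier A) (k : pedersenIdeal A) :
    (S - T).left k = S.left k - T.left k := rfl
theorem left_algebraMap (c : ℂ) (k : pedersenIdeal A) :
    (algebraMap ℂ (PedersenMultiplier A) c).left k = c • k := rfl
theorem right_algebraMap (c : ℂ) (k : pedersenIdeal A) :
    (algebraMap ℂ (PedersenMultiplier A) c).right k = c • k := rfl

theorem ext_left {S T : PedersenMultiplier A} (h : ∀ k, (S.left k : A) = T.left k) : S = T := by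
  refine ext' (fun k => Subtype.ext (h k)) fun k => Subtype.ext ?_
  refine eq_of_mul_pedersenIdeal_eq fun a ha => ?_
  rw [S.central k ⟨a, ha⟩, T.central k ⟨a, ha⟩, h]

theorem tendsto_iff {ι : Type*} {F : Filter ι} {u : ι → PedersenMultiplier A}
    {S : PedersenMultiplier A} :
    Tendsto u F (𝓝 S) ↔ (∀ k, Tendsto (fun i => ((u i).left k : A)) F (𝓝 (S.left k))) ∧
      ∀ k, Tendsto (fun i => ((u i).right k : A)) F (𝓝 (S.right k)) := by
  rw [nhds_induced, tendsto_comap_iff, nhds_prod_eq, tendsto_prod_iff', tendsto_pi_nhds,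
    tendsto_pi_nhds]
  rfl

instance : T2Space (PedersenMultiplier A) := by
  refine T2Space.of_injective_continuous (f := fun T : PedersenMultiplier A =>
    ((fun k => (T.left k : A), fun k => (T.right k : A)) :
      (pedersenIdeal A → A) × (pedersenIdeal A → A))) ?_ continuous_induced_dom
  intro S T h
  exact ext_left fun k => congrFun (congrArg Prod.fst h) k

end PedersenMultiplier

/-! ### Polynomials in symmetric operators -/

section SymmetricOperator

open Polynomial

variable {A : Type*} [NonUnitalCStarAlgebra A]
  {L : Type*} [NormedAddCommGroup L] [NormedSpace ℂ L] {ι : L →ₗᵢ[ℂ] A}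

/-- `S` and `S'` are adjoint to each other for the `A`-valued inner product
`⟪x, y⟫ = star x * y` on a space `L` embedded isometrically into `A`. -/
def IsStarAdjointPair (ι : L →ₗᵢ[ℂ] A) (S S' : L →L[ℂ] L) : Prop :=
  ∀ x y : L, star (ι (S x)) * ι y = star (ι x) * ι (S' y)

namespace IsStarAdjointPair

theorem symm {S S' : L →L[ℂ] L} (h : IsStarAdjointPair ι S S') : IsStarAdjointPair ι S' S := by
  intro x y
  have := congrArg star (h y x)
  simpa using this.symm

theorem mul {S S' R R' : L →L[ℂ] L} (h : IsStarAdjointPair ι S S') (h' : IsStarAdjointPair ι R R') :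
    IsStarAdjointPair ι (S * R) (R' * S') := fun x y => (h (R x) y).trans (h' x (S' y))

theorem add {S S' R R' : L →L[ℂ] L} (h : IsStarAdjointPair ι S S') (h' : IsStarAdjointPair ι R R') :
    IsStarAdjointPair ι (S + R) (S' + R') := fun x y => by
  have h1 := h x y
  have h2 := h' x y
  simp [add_mul, mul_add, h1, h2]

theorem scalar (c : ℂ) : IsStarAdjointPair ι (algebraMap ℂ (L →L[ℂ] L) c)
    (algebraMap ℂ (L →L[ℂ] L) (star c)) := fun x y => by
  simp [Algebra.algebraMap_eq_smul_one, smul_mul_assoc, mul_smul_comm]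

theorem aeval {S : L →L[ℂ] L} (h : IsStarAdjointPair ι S S) (p : ℂ[X]) :
    IsStarAdjointPair ι (Polynomial.aeval S p) (Polynomial.aeval S (p.map (starRingEnd ℂ))) := by
  induction p using Polynomial.induction_on' with
  | add p q hp hq => simpa using hp.add hq
  | monomial n c =>
    have hpow : IsStarAdjointPair ι (S ^ n) (S ^ n) := by
      induction n with
      | zero => intro x y; simp
      | succ n ih =>
        have := ih.mul h
        rwa [← pow_succ, ← pow_succ'] at this
    rw [Polynomial.map_monomial, aeval_monomial, aeval_monomial, Algebra.commutes (_ : ℂ) (S ^ n)]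
    rw [← Algebra.commutes c]
    have := (scalar (ι := ι) c).mul hpow
    rw [← Algebra.commutes] at this
    exact this

theorem norm_apply_sq_le {S S' : L →L[ℂ] L} (h : IsStarAdjointPair ι S S') (x : L) :
    ‖S x‖ ^ 2 ≤ ‖S' * S‖ * ‖x‖ ^ 2 := by
  have h1 : ‖S x‖ ^ 2 = ‖star (ι x) * ι ((S' * S) x)‖ := by
    rw [sq, ← ι.norm_map, ← CStarRing.norm_star_mul_self, h x (S x)]
    rfl
  calc ‖S x‖ ^ 2 ≤ ‖star (ι x)‖ * ‖ι ((S' * S) x)‖ := h1 ▸ norm_mul_le _ _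
    _ ≤ ‖x‖ * (‖S' * S‖ * ‖x‖) := by
      rw [norm_star, ι.norm_map, ι.norm_map]
      gcongr
      exact (S' * S).le_opNorm x
    _ = ‖S' * S‖ * ‖x‖ ^ 2 := by ring

theorem norm_sq_le {S S' : L →L[ℂ] L} (h : IsStarAdjointPair ι S S') :
    ‖S‖ ^ 2 ≤ ‖S' * S‖ := by
  have h1 : ‖S‖ ≤ Real.sqrt ‖S' * S‖ := by
    refine S.opNorm_le_bound (Real.sqrt_nonneg _) fun x => ?_
    refine le_of_sq_le_sq ?_ (by positivity)
    rw [mul_pow, Real.sq_sqrt (norm_nonneg _)]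
    exact h.norm_apply_sq_le x
  calc ‖S‖ ^ 2 ≤ Real.sqrt ‖S' * S‖ ^ 2 := by gcongr
    _ = _ := Real.sq_sqrt (norm_nonneg _)

theorem nnnorm_pow_two_pow {S : L →L[ℂ] L} (h : IsStarAdjointPair ι S S) (n : ℕ) :
    ‖S ^ 2 ^ n‖₊ = ‖S‖₊ ^ 2 ^ n := by
  induction n generalizing S with
  | zero => simp
  | succ n ih =>
    have h2 : ‖S * S‖₊ = ‖S‖₊ ^ 2 := by
      refine le_antisymm ((nnnorm_mul_le _ _).trans (sq ‖S‖₊).ge) ?_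
      exact_mod_cast h.norm_sq_le
    rw [pow_succ' 2 n, pow_mul, sq, ih (h.mul h), h2, ← pow_mul]

theorem spectralRadius_eq [CompleteSpace L] {S : L →L[ℂ] L} (h : IsStarAdjointPair ι S S) :
    spectralRadius ℂ S = ‖S‖₊ := by
  have hconst : Tendsto (fun _ : ℕ => (‖S‖₊ : ENNReal)) atTop (𝓝 ‖S‖₊) := tendsto_const_nhds
  refine tendsto_nhds_unique ?_ hconst
  convert! (spectrum.pow_nnnorm_pow_one_div_tendsto_nhds_spectralRadius S).comp
    (tendsto_pow_atTop_atTop_of_one_lt one_lt_two) using 1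
  refine funext fun n => ?_
  rw [Function.comp_apply, h.nnnorm_pow_two_pow, ENNReal.coe_pow, ← ENNReal.rpow_natCast,
    ← ENNReal.rpow_mul]
  simp

/-- The spectrum of a symmetric operator is real: `S + i n` has norm at most
`√(‖S‖² + n²)` for every real `n`, which bounds its spectrum. -/
theorem im_eq_zero_of_mem_spectrum [CompleteSpace L] [Nontrivial L] {S : L →L[ℂ] L}
    (h : IsStarAdjointPair ι S S) {z : ℂ} (hz : z ∈ spectrum ℂ S) : z.im = 0 := by
  have key : ∀ n : ℝ, z.re ^ 2 + (z.im + n) ^ 2 ≤ ‖S‖ ^ 2 + n ^ 2 := by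
    intro n
    set c : ℂ := n * Complex.I with hc
    have hadj := h.add (scalar (ι := ι) c)
    have hprod : (S + algebraMap ℂ (L →L[ℂ] L) (star c)) *
        (S + algebraMap ℂ (L →L[ℂ] L) c) =
        S * S + algebraMap ℂ (L →L[ℂ] L) ((n : ℂ) ^ 2) := by
      have h1 : star c = -c := by simp [hc]
      have h2 : c * c = -(n : ℂ) ^ 2 := by
        rw [hc, mul_mul_mul_comm, Complex.I_mul_I]; ring
      rw [h1, map_neg, add_mul, mul_add, mul_add, neg_mul, neg_mul, ← map_mul, h2,
        Algebra.commutes c S, map_neg]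
      abel
    have hmem : z + c ∈ spectrum ℂ (S + algebraMap ℂ (L →L[ℂ] L) c) := by
      rwa [add_comm S, spectrum.add_mem_iff, neg_add_cancel_left]
    have hle := spectrum.norm_le_norm_of_mem hmem
    have hsq : ‖z + c‖ ^ 2 = z.re ^ 2 + (z.im + n) ^ 2 := by
      rw [Complex.sq_norm, Complex.normSq_apply]
      simp [hc]
      ring
    calc z.re ^ 2 + (z.im + n) ^ 2 = ‖z + c‖ ^ 2 := hsq.symm
      _ ≤ ‖S + algebraMap ℂ (L →L[ℂ] L) c‖ ^ 2 := by gcongr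
      _ ≤ _ := hadj.norm_sq_le
      _ ≤ ‖S * S‖ + ‖algebraMap ℂ (L →L[ℂ] L) ((n : ℂ) ^ 2)‖ := by
        rw [hprod]; exact norm_add_le _ _
      _ ≤ ‖S‖ ^ 2 + n ^ 2 := by
        rw [norm_algebraMap', sq ‖S‖]
        gcongr
        · exact norm_mul_le _ _
        · simp
  by_contra hne
  have h1 := key ((‖S‖ ^ 2 + 1) / (2 * z.im))
  have h2 : 2 * z.im * ((‖S‖ ^ 2 + 1) / (2 * z.im)) = ‖S‖ ^ 2 + 1 := by field_simp
  nlinarith [sq_nonneg z.re, sq_nonneg z.im]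

/-- A polynomial in a symmetric operator `S` is bounded by the supremum of the polynomial on
the interval `[-‖S‖, ‖S‖]`. -/
theorem norm_aeval_le [CompleteSpace L] {S : L →L[ℂ] L} (h : IsStarAdjointPair ι S S) (p : ℂ[X])
    {R M : ℝ} (hR : ‖S‖ ≤ R) (hM : 0 ≤ M) (hp : ∀ t : ℝ, |t| ≤ R → ‖p.eval (t : ℂ)‖ ≤ M) :
    ‖Polynomial.aeval S p‖ ≤ M := by
  rcases subsingleton_or_nontrivial L with hL | hL
  · rw [Subsingleton.elim (Polynomial.aeval S p) 0, norm_zero]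
    exact hM
  set q : ℂ[X] := p.map (starRingEnd ℂ) * p
  have hq := (h.aeval p)
  have hprod : Polynomial.aeval S (p.map (starRingEnd ℂ)) * Polynomial.aeval S p =
      Polynomial.aeval S q := (map_mul _ _ _).symm
  have hsymm : IsStarAdjointPair ι (Polynomial.aeval S q) (Polynomial.aeval S q) := by
    rw [← hprod]
    exact hq.symm.mul hq
  have hrad : spectralRadius ℂ (Polynomial.aeval S q) ≤ ENNReal.ofReal (M ^ 2) := by
    refine iSup₂_le fun w hw => ?_
    rw [spectrum.map_polynomial_aeval] at hw
    obtain ⟨z, hz, rfl⟩ := hw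
    have hzre : z = (z.re : ℂ) := Complex.ext rfl (by simp [h.im_eq_zero_of_mem_spectrum hz])
    have hzR : |z.re| ≤ R := (Complex.abs_re_le_norm z).trans
      ((spectrum.norm_le_norm_of_mem hz).trans hR)
    have hev : eval z (p.map (starRingEnd ℂ)) = starRingEnd ℂ (eval z p) := by
      have : z = starRingEnd ℂ z := by rw [hzre, Complex.conj_ofReal]
      nth_rewrite 1 [this]
      rw [eval_map, eval₂_at_apply]
    have hq2 : ‖eval z q‖ = ‖eval z p‖ ^ 2 := by
      rw [eval_mul, hev, norm_mul, RCLike.norm_conj, ← sq]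
    change ENNReal.ofNNReal ‖eval z q‖₊ ≤ _
    rw [← ENNReal.ofReal_coe_nnreal, coe_nnnorm, hq2]
    refine ENNReal.ofReal_le_ofReal ?_
    have := hp z.re hzR
    rw [← hzre] at this
    gcongr
  rw [hsymm.spectralRadius_eq] at hrad
  have h1 : ‖Polynomial.aeval S q‖ ≤ M ^ 2 := by
    rwa [← ENNReal.ofReal_coe_nnreal, coe_nnnorm, ENNReal.ofReal_le_ofReal_iff (by positivity)]
      at hrad
  refine le_of_sq_le_sq ?_ hM
  exact hq.norm_sq_le.trans (hprod ▸ h1)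

end IsStarAdjointPair

end SymmetricOperator

/-! ### The functional calculus of a self-adjoint multiplier -/

section RightUnitIdeal

variable {A : Type*} [NonUnitalCStarAlgebra A]

/-- The closed left ideal of all elements for which `e` is a right unit. -/
def rightUnitIdeal (e : A) : Submodule ℂ A where
  carrier := {l | l * e = l}
  add_mem' {a b} (ha : a * e = a) (hb : b * e = b) := by
    change (a + b) * e = a + b
    rw [add_mul, ha, hb]
  zero_mem' := zero_mul e
  smul_mem' c a (ha : a * e = a) := by
    change (c • a) * e = c • a
    rw [smul_mul_assoc, ha]

theorem isClosed_rightUnitIdeal (e : A) : IsClosed (rightUnitIdeal e : Set A) :=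
  isClosed_eq (continuous_mul_const e) continuous_id

instance (e : A) : CompleteSpace (rightUnitIdeal e) :=
  (isClosed_rightUnitIdeal e).completeSpace_coe

theorem rightUnitIdeal_le (e : A) : rightUnitIdeal e ≤ pedersenIdeal A :=
  fun _ h => mem_pedersenIdeal_of_mul_eq h

end RightUnitIdeal

namespace PedersenMultiplier

open Polynomial

variable {A : Type*} [NonUnitalCStarAlgebra A]

theorem left_mem_rightUnitIdeal (T : PedersenMultiplier A) {e : A} {k : pedersenIdeal A}
    (hk : (k : A) ∈ rightUnitIdeal e) : (T.left k : A) ∈ rightUnitIdeal e := by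
  change (T.left k : A) * e = T.left k
  rw [← left_mul_right]
  congr 2
  exact Subtype.ext hk

/-- The restriction of a multiplier to the closed left ideal `rightUnitIdeal e`, on which it
is bounded by the closed graph theorem. -/
def restrict (T : PedersenMultiplier A) (e : A) : rightUnitIdeal e →L[ℂ] rightUnitIdeal e where
  toLinearMap := (((pedersenIdeal A).subtype ∘ₗ T.left ∘ₗ
    Submodule.inclusion (rightUnitIdeal_le e)).codRestrict (rightUnitIdeal e)
      fun l => T.left_mem_rightUnitIdeal (k := Submodule.inclusion (rightUnitIdeal_le e) l) l.2)
  cont := by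
    refine LinearMap.continuous_of_seq_closed_graph _ fun u x y hu hTu => ?_
    refine Subtype.ext (eq_of_pedersenIdeal_mul_eq fun a ha => ?_)
    have hu' : Tendsto (fun n => (u n : A)) atTop (𝓝 x) := (continuous_subtype_val.tendsto _).comp hu
    have h1 := (continuous_subtype_val.tendsto _).comp hTu
    have h2 := h1.const_mul a
    have h3 := hu'.const_mul (T.right ⟨a, ha⟩ : A)
    refine (tendsto_nhds_unique h2 (h3.congr fun n => ?_)).trans
      (T.central ⟨a, ha⟩ (Submodule.inclusion (rightUnitIdeal_le e) x))
    exact T.central ⟨a, ha⟩ (Submodule.inclusion (rightUnitIdeal_le e) (u n))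

theorem coe_restrict (T : PedersenMultiplier A) (e : A) (l : rightUnitIdeal e) :
    (T.restrict e l : A) = T.left (Submodule.inclusion (rightUnitIdeal_le e) l) := rfl

theorem restrict_mul (S T : PedersenMultiplier A) (e : A) :
    (S * T).restrict e = S.restrict e * T.restrict e := by
  ext l
  simp only [coe_restrict, left_mul]
  rfl

theorem restrict_aeval (T : PedersenMultiplier A) (e : A) (p : ℂ[X]) :
    (aeval T p).restrict e = aeval (T.restrict e) p := by
  have hadd : ∀ S T : PedersenMultiplier A, (S + T).restrict e = S.restrict e + T.restrict e :=
    fun S T => rfl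
  have halg : ∀ c : ℂ, (algebraMap ℂ (PedersenMultiplier A) c).restrict e =
      algebraMap ℂ (rightUnitIdeal e →L[ℂ] rightUnitIdeal e) c := fun c => rfl
  have hpow : ∀ n : ℕ, (T ^ n).restrict e = T.restrict e ^ n := by
    intro n
    induction n with
    | zero => rfl
    | succ n ih => rw [pow_succ, pow_succ, restrict_mul, ih]
  induction p using Polynomial.induction_on' with
  | add p q hp hq => rw [map_add, map_add, hadd, hp, hq]
  | monomial n c => rw [aeval_monomial, aeval_monomial, restrict_mul, halg, hpow]

theorem isStarAdjointPair_restrict {T : PedersenMultiplier A} (hT : IsSelfAdjoint T) (e : A) :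
    IsStarAdjointPair (rightUnitIdeal e).subtypeₗᵢ (T.restrict e) (T.restrict e) :=
  fun x y => by
    have h := star_left_mul T (Submodule.inclusion (rightUnitIdeal_le e) x)
      (Submodule.inclusion (rightUnitIdeal_le e) y)
    rwa [hT.star_eq] at h

/-- On elements with the right unit `e`, polynomials in a self-adjoint multiplier are controlled by
their values on a bounded interval. -/
theorem exists_norm_aeval_left_le {T : PedersenMultiplier A} (hT : IsSelfAdjoint T) (e : A) :
    ∃ R : ℝ, ∀ (p : ℂ[X]) (M : ℝ), 0 ≤ M → (∀ t : ℝ, |t| ≤ R → ‖p.eval (t : ℂ)‖ ≤ M) →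
      ∀ k : pedersenIdeal A, (k : A) ∈ rightUnitIdeal e →
        ‖((aeval T p).left k : A)‖ ≤ M * ‖(k : A)‖ := by
  refine ⟨‖T.restrict e‖, fun p M hM hp k hk => ?_⟩
  have h := (isStarAdjointPair_restrict hT e).norm_aeval_le p le_rfl hM hp
  have h2 := (aeval (T.restrict e) p).le_of_opNorm_le h ⟨k, hk⟩
  rw [← restrict_aeval] at h2
  exact h2

theorem star_algebraMap (c : ℂ) :
    star (algebraMap ℂ (PedersenMultiplier A) c) = algebraMap ℂ (PedersenMultiplier A) (star c) :=
  ext' (fun k => by rw [left_star, right_algebraMap, left_algebraMap, starK_smul, starK_starK])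
    (fun k => by rw [right_star, left_algebraMap, right_algebraMap, starK_smul, starK_starK])

theorem star_aeval {T : PedersenMultiplier A} (hT : IsSelfAdjoint T) (p : ℂ[X]) :
    star (aeval T p) = aeval T (p.map (starRingEnd ℂ)) := by
  induction p using Polynomial.induction_on' with
  | add p q hp hq => rw [map_add, star_add, hp, hq, Polynomial.map_add, map_add]
  | monomial n c =>
    rw [aeval_monomial, Polynomial.map_monomial, aeval_monomial, star_mul, star_pow, hT.star_eq,
      star_algebraMap, ← Algebra.commutes (star c)]
    rfl

end PedersenMultiplier

section PolynomialsOnTheLine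

open Polynomial

theorem aeval_idFun_apply (p : ℂ[X]) (t : ℝ) : aeval idFun p t = p.eval (t : ℂ) := by
  induction p using Polynomial.induction_on' with
  | add p q hp hq => rw [map_add, eval_add, ContinuousMap.add_apply, hp, hq]
  | monomial n c =>
    rw [aeval_monomial, eval_monomial, ContinuousMap.mul_apply, ContinuousMap.pow_apply]
    rfl

theorem exists_polynomial_norm_sub_lt (f : C(ℝ, ℂ)) (R : ℝ) {ε : ℝ} (hε : 0 < ε) :
    ∃ p : ℂ[X], ∀ t : ℝ, |t| ≤ R → ‖f t - aeval idFun p t‖ < ε := by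
  obtain ⟨p, hp⟩ := exists_polynomial_near_of_continuousOn (-R) R (fun t => (f t).re)
    (by fun_prop) (ε / 2) (half_pos hε)
  obtain ⟨q, hq⟩ := exists_polynomial_near_of_continuousOn (-R) R (fun t => (f t).im)
    (by fun_prop) (ε / 2) (half_pos hε)
  refine ⟨p.map (algebraMap ℝ ℂ) + C Complex.I * q.map (algebraMap ℝ ℂ), fun t ht => ?_⟩
  have h1 := hp t (abs_le.mp ht)
  have h2 := hq t (abs_le.mp ht)
  have he : ∀ r : ℝ[X], eval (t : ℂ) (r.map (algebraMap ℝ ℂ)) = ((eval t r : ℝ) : ℂ) := fun r => by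
    rw [eval_map, show (t : ℂ) = algebraMap ℝ ℂ t from rfl, eval₂_at_apply]
    rfl
  rw [aeval_idFun_apply, eval_add, eval_mul, eval_C, he, he]
  refine (Complex.norm_le_abs_re_add_abs_im _).trans_lt ?_
  simp only [Complex.sub_re, Complex.add_re, Complex.mul_re, Complex.I_re, Complex.ofReal_re,
    Complex.I_im, Complex.ofReal_im, Complex.sub_im, Complex.add_im, Complex.mul_im]
  rw [abs_sub_comm] at h1 h2
  simp only [zero_mul, one_mul, mul_zero, sub_zero, add_zero, zero_add]
  linarith

theorem continuous_star_continuousMap : Continuous (star : C(ℝ, ℂ) → C(ℝ, ℂ)) :=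
  ContinuousMap.continuous_postcomp ⟨star, continuous_star⟩

theorem denseRange_aeval_idFun : DenseRange (aeval idFun : ℂ[X] →ₐ[ℂ] C(ℝ, ℂ)) := by
  intro f
  choose p hp using fun n : ℕ => exists_polynomial_norm_sub_lt f n (Nat.one_div_pos_of_nat (n := n))
  have : Tendsto (fun n => aeval idFun (p n)) atTop (𝓝 f) := by
    rw [ContinuousMap.tendsto_iff_forall_isCompact_tendstoUniformlyOn]
    intro K hK
    rw [Metric.tendstoUniformlyOn_iff]
    intro ε hε
    obtain ⟨R, hR⟩ := hK.isBounded.exists_norm_le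
    obtain ⟨N, hN⟩ := exists_nat_ge R
    filter_upwards [eventually_ge_atTop N,
      tendsto_one_div_add_atTop_nhds_zero_nat.eventually (gt_mem_nhds hε)] with n hn hn2 t ht
    rw [dist_eq_norm]
    refine (hp n t ((hR t ht).trans (hN.trans ?_))).trans hn2
    exact_mod_cast hn
  exact mem_closure_of_tendsto this (Eventually.of_forall fun n => ⟨_, rfl⟩)

/-- The filter on polynomials that expresses convergence to `f`, uniformly on compact sets. -/
noncomputable def polynomialsNear (f : C(ℝ, ℂ)) : Filter ℂ[X] :=
  comap (aeval idFun) (𝓝 f)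

instance (f : C(ℝ, ℂ)) : NeBot (polynomialsNear f) :=
  comap_neBot_iff_frequently.mpr
    (mem_closure_iff_frequently.mp (denseRange_aeval_idFun f))

theorem tendsto_polynomialsNear {ι : Type*} {F : Filter ι} {p : ι → ℂ[X]} {f : C(ℝ, ℂ)} :
    Tendsto p F (polynomialsNear f) ↔ Tendsto (fun i => aeval idFun (p i)) F (𝓝 f) :=
  tendsto_comap_iff

theorem tendsto_aeval_idFun (f : C(ℝ, ℂ)) :
    Tendsto (fun p => aeval idFun p) (polynomialsNear f) (𝓝 f) :=
  tendsto_comap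

theorem aeval_idFun_map_conj (p : ℂ[X]) :
    aeval idFun (p.map (starRingEnd ℂ)) = star (aeval idFun p) := by
  ext t
  rw [ContinuousMap.star_apply, aeval_idFun_apply, aeval_idFun_apply, eval_map]
  nth_rewrite 1 [← Complex.conj_ofReal t]
  rw [eval₂_at_apply]
  rfl

theorem eventually_polynomialsNear (f : C(ℝ, ℂ)) (R : ℝ) {ε : ℝ} (hε : 0 < ε) :
    ∀ᶠ p in polynomialsNear f, ∀ t : ℝ, |t| ≤ R → ‖f t - p.eval (t : ℂ)‖ < ε := by
  have h := tendsto_aeval_idFun f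
  rw [ContinuousMap.tendsto_iff_forall_isCompact_tendstoUniformlyOn] at h
  have h2 := Metric.tendstoUniformlyOn_iff.mp (h _ (isCompact_Icc (a := -R) (b := R))) ε hε
  filter_upwards [h2] with p hp t ht
  rw [← aeval_idFun_apply, ← dist_eq_norm]
  exact hp t (abs_le.mp ht)

/-- A function that is at every point the limit of `u` along a dense map is continuous. -/
theorem continuous_of_forall_tendsto_comap {P X Y : Type*} [TopologicalSpace X]
    [TopologicalSpace Y] [T3Space Y] {i : P → X} (hi : DenseRange i) {u : P → Y} {g : X → Y}
    (h : ∀ x, Tendsto u (comap i (𝓝 x)) (𝓝 (g x))) : Continuous g := by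
  let : TopologicalSpace P := TopologicalSpace.induced i inferInstance
  have di : IsDenseInducing i := ⟨⟨rfl⟩, hi⟩
  have hg : di.extend u = g := funext fun x => di.extend_eq_of_tendsto (h x)
  exact hg ▸ di.continuous_extend fun x => ⟨g x, h x⟩

end PolynomialsOnTheLine

namespace PedersenMultiplier

open Polynomial

variable {A : Type*} [NonUnitalCStarAlgebra A]

/-- If polynomials converge to `f` uniformly on compact sets, then their values at `T` converge on
Pedersen's ideal, and the limits stay in the ideal. -/
theorem exists_tendsto_aeval_left {T : PedersenMultiplier A} (hT : IsSelfAdjoint T) (f : C(ℝ, ℂ))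
    (k : pedersenIdeal A) :
    ∃ y : pedersenIdeal A,
      Tendsto (fun p => ((aeval T p).left k : A)) (polynomialsNear f) (𝓝 (y : A)) := by
  obtain ⟨k, hk⟩ := k
  have hk' : k ∈ rightUnitSpan A := pedersenIdeal_eq_rightUnitSpan (A := A) ▸ hk
  revert hk
  induction hk' using Submodule.span_induction with
  | mem x h =>
    obtain ⟨l, e, z, h, rfl⟩ := h
    intro hk
    have hl : l ∈ pedersenIdeal A := mem_pedersenIdeal_of_mul_eq h
    obtain ⟨R, hR⟩ := exists_norm_aeval_left_le hT e
    have hc : Cauchy (map (fun p => ((aeval T p).left ⟨l, hl⟩ : A)) (polynomialsNear f)) := by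
      rw [Metric.cauchy_iff]
      refine ⟨inferInstance, fun ε hε => ?_⟩
      set δ : ℝ := ε / (2 * (‖l‖ + 1)) with hδ
      have hδ0 : 0 < δ := by positivity
      refine ⟨_, image_mem_map (eventually_polynomialsNear f R hδ0), ?_⟩
      rintro _ ⟨p, hp, rfl⟩ _ ⟨q, hq, rfl⟩
      have h1 := hR (p - q) (2 * δ) (by positivity) (fun t ht => by
        have h3 := hp t ht
        have h4 := hq t ht
        rw [eval_sub, show eval (t : ℂ) p - eval (t : ℂ) q =
          (f t - eval (t : ℂ) q) - (f t - eval (t : ℂ) p) by ring]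
        exact (norm_sub_le _ _).trans (by linarith)) ⟨l, hl⟩ h
      rw [map_sub, left_sub] at h1
      rw [dist_eq_norm]
      refine lt_of_le_of_lt h1 ?_
      change 2 * δ * ‖l‖ < ε
      have : 2 * δ * (‖l‖ + 1) = ε := by rw [hδ]; field_simp
      nlinarith
    obtain ⟨y, hy⟩ := CompleteSpace.complete hc
    have hye : y ∈ rightUnitIdeal e := (isClosed_rightUnitIdeal e).mem_of_tendsto
      (f := fun p => ((aeval T p).left ⟨l, hl⟩ : A)) hy
      (Eventually.of_forall fun p => left_mem_rightUnitIdeal _ h)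
    refine ⟨⟨y * z, mul_mem_pedersenIdeal_right z (rightUnitIdeal_le e hye)⟩, ?_⟩
    have hy' : Tendsto (fun p => ((aeval T p).left ⟨l, hl⟩ : A)) (polynomialsNear f) (𝓝 y) := hy
    exact (hy'.mul_const z).congr fun p => (left_mul_right (aeval T p) ⟨l, hl⟩ z).symm
  | zero =>
    intro hk
    refine ⟨0, tendsto_const_nhds.congr fun p => ?_⟩
    have : (⟨0, hk⟩ : pedersenIdeal A) = 0 := rfl
    rw [this, map_zero]
  | add x y hx hy ihx ihy =>
    intro hk
    rw [show Submodule.span ℂ _ = rightUnitSpan A from rfl, ← pedersenIdeal_eq_rightUnitSpan]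
      at hx hy
    obtain ⟨u, hu⟩ := ihx hx
    obtain ⟨v, hv⟩ := ihy hy
    refine ⟨u + v, (hu.add hv).congr fun p => ?_⟩
    have : (⟨x + y, hk⟩ : pedersenIdeal A) = ⟨x, hx⟩ + ⟨y, hy⟩ := rfl
    rw [this, map_add]
    rfl
  | smul c x hx ihx =>
    intro hk
    rw [show Submodule.span ℂ _ = rightUnitSpan A from rfl, ← pedersenIdeal_eq_rightUnitSpan]
      at hx
    obtain ⟨u, hu⟩ := ihx hx
    refine ⟨c • u, (hu.const_smul c).congr fun p => ?_⟩
    have : (⟨c • x, hk⟩ : pedersenIdeal A) = c • ⟨x, hx⟩ := rfl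
    rw [this, map_smul]
    rfl

theorem exists_tendsto_aeval_right {T : PedersenMultiplier A} (hT : IsSelfAdjoint T)
    (f : C(ℝ, ℂ)) (k : pedersenIdeal A) :
    ∃ y : pedersenIdeal A,
      Tendsto (fun p => ((aeval T p).right k : A)) (polynomialsNear f) (𝓝 (y : A)) := by
  obtain ⟨y, hy⟩ := exists_tendsto_aeval_left hT (star f) (starK k)
  refine ⟨starK y, ?_⟩
  have h1 : Tendsto (fun p : ℂ[X] => p.map (starRingEnd ℂ)) (polynomialsNear f)
      (polynomialsNear (star f)) := by
    rw [tendsto_polynomialsNear]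
    simp only [aeval_idFun_map_conj]
    exact (continuous_star_continuousMap.tendsto f).comp (tendsto_aeval_idFun f)
  refine ((continuous_star.tendsto _).comp (hy.comp h1)).congr fun p => ?_
  simp only [Function.comp_apply, ← star_aeval hT, left_star, starK_starK]
  exact star_star _

theorem exists_tendsto_aeval {T : PedersenMultiplier A} (hT : IsSelfAdjoint T) (f : C(ℝ, ℂ)) :
    ∃ S : PedersenMultiplier A, Tendsto (fun p => aeval T p) (polynomialsNear f) (𝓝 S) := by
  choose l hl using exists_tendsto_aeval_left hT f
  choose r hr using exists_tendsto_aeval_right hT f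
  have huniq : ∀ {u : ℂ[X] → A} {y z : pedersenIdeal A},
      Tendsto u (polynomialsNear f) (𝓝 (y : A)) → Tendsto u (polynomialsNear f) (𝓝 (z : A)) →
      y = z := fun hy hz => Subtype.ext (tendsto_nhds_unique hy hz)
  let l' : pedersenIdeal A →ₗ[ℂ] pedersenIdeal A :=
    { toFun := l
      map_add' x y := huniq (hl (x + y)) (((hl x).add (hl y)).congr fun p => by
        rw [map_add]; rfl)
      map_smul' c x := huniq (hl (c • x)) (((hl x).const_smul c).congr fun p => by
        rw [map_smul]; rfl) }
  let r' : pedersenIdeal A →ₗ[ℂ] pedersenIdeal A :=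
    { toFun := r
      map_add' x y := huniq (hr (x + y)) (((hr x).add (hr y)).congr fun p => by
        rw [map_add]; rfl)
      map_smul' c x := huniq (hr (c • x)) (((hr x).const_smul c).congr fun p => by
        rw [map_smul]; rfl) }
  let S : PedersenMultiplier A := ⟨(l', MulOpposite.op r'), fun a b =>
    tendsto_nhds_unique ((hr a).mul_const (b : A))
      (((hl b).const_mul (a : A)).congr fun p => ((aeval T p).central a b).symm)⟩
  exact ⟨S, tendsto_iff.mpr ⟨hl, hr⟩⟩

/-- The value at `f` of the functional calculus of a self-adjoint multiplier: the limit of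
the values at `T` of polynomials converging to `f` uniformly on compact sets. -/
noncomputable def calculusFun {T : PedersenMultiplier A} (hT : IsSelfAdjoint T) (f : C(ℝ, ℂ)) :
    PedersenMultiplier A :=
  (exists_tendsto_aeval hT f).choose

theorem tendsto_calculusFun {T : PedersenMultiplier A} (hT : IsSelfAdjoint T) (f : C(ℝ, ℂ)) :
    Tendsto (fun p => aeval T p) (polynomialsNear f) (𝓝 (calculusFun hT f)) :=
  (exists_tendsto_aeval hT f).choose_spec

theorem calculusFun_eq {T : PedersenMultiplier A} (hT : IsSelfAdjoint T) {f : C(ℝ, ℂ)}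
    {ι : Type*} {F : Filter ι} [NeBot F] {p : ι → ℂ[X]} {S : PedersenMultiplier A}
    (hp : Tendsto (fun i => aeval idFun (p i)) F (𝓝 f))
    (hS : Tendsto (fun i => aeval T (p i)) F (𝓝 S)) : calculusFun hT f = S :=
  tendsto_nhds_unique ((tendsto_calculusFun hT f).comp (tendsto_polynomialsNear.mpr hp)) hS

theorem calculusFun_aeval {T : PedersenMultiplier A} (hT : IsSelfAdjoint T) (p : ℂ[X]) :
    calculusFun hT (aeval idFun p) = aeval T p :=
  calculusFun_eq hT (F := (pure () : Filter Unit)) (p := fun _ => p) tendsto_const_nhds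
    tendsto_const_nhds

/-- The continuous functional calculus `C(ℝ) → Γ(K(A))` of a self-adjoint multiplier. -/
noncomputable def calculus {T : PedersenMultiplier A} (hT : IsSelfAdjoint T) :
    C(ℝ, ℂ) →⋆ₐ[ℂ] PedersenMultiplier A where
  toFun := calculusFun hT
  map_one' := by simpa using calculusFun_aeval hT 1
  map_zero' := by simpa using calculusFun_aeval hT 0
  commutes' c := by simpa using calculusFun_aeval hT (C c)
  map_add' f g := by
    have hf := tendsto_iff.mp ((tendsto_calculusFun hT f).comp
      (tendsto_fst (g := polynomialsNear g)))
    have hg := tendsto_iff.mp ((tendsto_calculusFun hT g).comp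
      (tendsto_snd (f := polynomialsNear f)))
    refine calculusFun_eq hT (F := polynomialsNear f ×ˢ polynomialsNear g)
      (p := fun x => x.1 + x.2) ?_ (tendsto_iff.mpr ⟨fun k => ?_, fun k => ?_⟩)
    · simp only [map_add]
      exact ((tendsto_aeval_idFun f).comp tendsto_fst).add ((tendsto_aeval_idFun g).comp tendsto_snd)
    · exact ((hf.1 k).add (hg.1 k)).congr fun x => by rw [map_add]; rfl
    · exact ((hf.2 k).add (hg.2 k)).congr fun x => by rw [map_add]; rfl
  map_mul' f g := by
    -- multiplication is only separately `κ`-continuous: the identity `a (p q)(T) k =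
    -- (a p(T)) (q(T) k)` reduces it to the multiplication of `A`
    refine ext_left fun k => eq_of_pedersenIdeal_mul_eq fun a ha => ?_
    have hf := (tendsto_iff.mp ((tendsto_calculusFun hT f).comp
      (tendsto_fst (g := polynomialsNear g)))).2 ⟨a, ha⟩
    have hg := (tendsto_iff.mp ((tendsto_calculusFun hT g).comp
      (tendsto_snd (f := polynomialsNear f)))).1 k
    have hmul : Tendsto (fun x : ℂ[X] × ℂ[X] => x.1 * x.2)
        (polynomialsNear f ×ˢ polynomialsNear g) (polynomialsNear (f * g)) := by
      rw [tendsto_polynomialsNear]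
      simp only [map_mul]
      exact ((tendsto_aeval_idFun f).comp tendsto_fst).mul ((tendsto_aeval_idFun g).comp tendsto_snd)
    have hfg := (tendsto_iff.mp ((tendsto_calculusFun hT (f * g)).comp hmul)).1 k
    refine (tendsto_nhds_unique (hfg.const_mul a) ((hf.mul hg).congr fun x => ?_)).trans
      ((calculusFun hT f).central ⟨a, ha⟩ ((calculusFun hT g).left k))
    simp only [Function.comp_apply]
    rw [map_mul, left_mul]
    exact (aeval T x.1).central ⟨a, ha⟩ ((aeval T x.2).left k)
  map_star' f := by
    have hf := tendsto_iff.mp (tendsto_calculusFun hT f)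
    refine calculusFun_eq hT (F := polynomialsNear f)
      (p := fun p => p.map (starRingEnd ℂ)) ?_ (tendsto_iff.mpr ⟨fun k => ?_, fun k => ?_⟩)
    · simp only [aeval_idFun_map_conj]
      exact (continuous_star_continuousMap.tendsto f).comp (tendsto_aeval_idFun f)
    · refine ((continuous_star.tendsto _).comp (hf.2 (starK k))).congr fun p => ?_
      rw [← star_aeval hT]
      rfl
    · refine ((continuous_star.tendsto _).comp (hf.1 (starK k))).congr fun p => ?_
      rw [← star_aeval hT]
      rfl

variable {T : PedersenMultiplier A} (hT : IsSelfAdjoint T)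

theorem calculus_idFun : calculus hT idFun = T := by
  have h := calculusFun_aeval hT X
  rwa [aeval_X, aeval_X] at h

theorem continuous_calculus : Continuous (calculus hT) := by
  refine continuous_induced_rng.mpr (Continuous.prodMk (continuous_pi fun k => ?_)
    (continuous_pi fun k => ?_))
  · exact continuous_of_forall_tendsto_comap denseRange_aeval_idFun
      (u := fun p => ((aeval T p).left k : A)) fun f => (tendsto_iff.mp (tendsto_calculusFun hT f)).1 k
  · exact continuous_of_forall_tendsto_comap denseRange_aeval_idFun
      (u := fun p => ((aeval T p).right k : A)) fun f => (tendsto_iff.mp (tendsto_calculusFun hT f)).2 k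

theorem calculus_unique (ψ : C(ℝ, ℂ) →⋆ₐ[ℂ] PedersenMultiplier A) (hψ : Continuous ψ)
    (h : ψ idFun = T) : ψ = calculus hT := by
  refine DFunLike.coe_injective (denseRange_aeval_idFun.equalizer hψ (continuous_calculus hT) ?_)
  refine funext fun p => ?_
  simp only [Function.comp_apply]
  rw [← aeval_algHom_apply, ← aeval_algHom_apply, calculus_idFun, h]

end PedersenMultiplier

/-! ### Bounded functions and the multiplier algebra -/

section MultiplierAlgebraLemmas

variable {A : Type*} [NonUnitalCStarAlgebra A]

namespace DoubleCentralizer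

theorem star_fst_mul (m : 𝓜(ℂ, A)) (a b : A) :
    star (m.fst a) * b = star a * (star m).fst b := by
  have h := (star m).central (star a) b
  rwa [star_snd, star_star] at h

theorem ext_fst {m m' : 𝓜(ℂ, A)} (h : ∀ a, m.fst a = m'.fst a) : m = m' := by
  have h2 : ‖m - m'‖ = 0 := by
    rw [← norm_fst, sub_fst, norm_eq_zero, sub_eq_zero]
    exact ContinuousLinearMap.ext h
  rwa [norm_eq_zero, sub_eq_zero] at h2

theorem mul_fst_apply (m m' : 𝓜(ℂ, A)) (a : A) : (m * m').fst a = m.fst (m'.fst a) := by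
  rw [mul_fst]
  rfl

end DoubleCentralizer

open DoubleCentralizer

variable {B : Type*} [CStarAlgebra B]

theorem isSelfAdjoint_cfc_sqrt (z : B) : IsSelfAdjoint (cfc Real.sqrt (1 - star z * z)) :=
  cfc_predicate _ _

/-- The functional calculus defining `(1 - z⋆z)^{1/2}` gives a square root as soon as `‖z‖ ≤ 1`. -/
theorem cfc_sqrt_mul_self {z : B} (hz : ‖z‖ ≤ 1) :
    cfc Real.sqrt (1 - star z * z) * cfc Real.sqrt (1 - star z * z) = 1 - star z * z := by
  rcases subsingleton_or_nontrivial B with hB | hB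
  · exact Subsingleton.elim _ _
  have hsa : IsSelfAdjoint (1 - star z * z) := (IsSelfAdjoint.one B).sub (IsSelfAdjoint.star_mul_self z)
  have hpos : ∀ x ∈ spectrum ℝ (1 - star z * z), 0 ≤ x := by
    intro x hx
    rw [← map_one (algebraMap ℝ B), ← spectrum.singleton_sub_eq] at hx
    obtain ⟨_, rfl, y, hy, rfl⟩ := Set.mem_sub.mp hx
    have h1 := spectrum.norm_le_norm_of_mem hy
    rw [CStarRing.norm_star_mul_self] at h1
    have h2 : y ≤ 1 := (le_abs_self y).trans (h1.trans (mul_le_one₀ hz (norm_nonneg _) hz))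
    linarith
  rw [← cfc_mul Real.sqrt Real.sqrt _ (by fun_prop) (by fun_prop)]
  refine (cfc_congr fun x hx => Real.mul_self_sqrt (hpos x hx)).trans (cfc_id' ℝ _)

theorem cfc_sqrt_star_mul_self_sq (v : B) :
    cfc Real.sqrt ((star v * v) * (star v * v)) = star v * v := by
  have hsa := IsSelfAdjoint.star_mul_self v
  rw [← sq, ← cfc_pow_id (R := ℝ) (star v * v) 2, ← cfc_comp' Real.sqrt (· ^ 2) (star v * v)]
  refine (cfc_congr fun x hx => ?_).trans (cfc_id' ℝ _)
  exact Real.sqrt_sq (spectrum_star_mul_self_nonneg x hx)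

theorem spectrum_subset_Icc_of_isSelfAdjoint {z : B} (hsa : IsSelfAdjoint z) (hz : ‖z‖ ≤ 1) :
    spectrum ℂ z ⊆ (fun t : ℝ => (t : ℂ)) '' Set.Icc (-1) 1 := by
  rcases subsingleton_or_nontrivial B with hB | hB
  · simp [spectrum.of_subsingleton]
  intro w hw
  refine ⟨w.re, abs_le.mp ?_, (hsa.mem_spectrum_eq_re hw).symm⟩
  exact (Complex.abs_re_le_norm w).trans ((spectrum.norm_le_norm_of_mem hw).trans hz)

theorem norm_sq_le_norm_add_star_mul_self (x y : A) :
    ‖x‖ ^ 2 ≤ ‖star x * x + star y * y‖ := by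
  let := CStarAlgebra.spectralOrder A
  have := CStarAlgebra.spectralOrderedRing A
  rw [sq, ← CStarRing.norm_star_mul_self]
  exact CStarAlgebra.norm_le_norm_of_nonneg_of_le (star_mul_self_nonneg x)
    (le_add_of_nonneg_right (star_mul_self_nonneg y))

end MultiplierAlgebraLemmas

namespace PedersenMultiplier

open DoubleCentralizer

variable {A : Type*} [NonUnitalCStarAlgebra A]

namespace IsRestrictionOf

variable {S S' : PedersenMultiplier A} {m m' : 𝓜(ℂ, A)}

theorem unique (h : S.IsRestrictionOf m) (h' : S.IsRestrictionOf m') : m = m' :=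
  ext_fst fun a => congrFun (Continuous.ext_on dense_pedersenIdeal m.fst.continuous
    m'.fst.continuous fun k hk => ((h ⟨k, hk⟩).1.symm.trans (h' ⟨k, hk⟩).1)) a

theorem mul (h : S.IsRestrictionOf m) (h' : S'.IsRestrictionOf m') :
    (S * S').IsRestrictionOf (m * m') := fun k => by
  rw [left_mul, right_mul, mul_fst, mul_snd, (h _).1, (h' _).2, (h' _).1, (h _).2]
  exact ⟨rfl, rfl⟩

theorem add (h : S.IsRestrictionOf m) (h' : S'.IsRestrictionOf m') :
    (S + S').IsRestrictionOf (m + m') := fun k => by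
  rw [left_add, right_add, add_fst, add_snd, Submodule.coe_add, Submodule.coe_add, (h _).1,
    (h' _).2, (h' _).1, (h _).2]
  exact ⟨rfl, rfl⟩

theorem star (h : S.IsRestrictionOf m) : (star S).IsRestrictionOf (star m) := fun k => by
  rw [left_star, right_star, star_fst, star_snd]
  exact ⟨congrArg _ (h (starK k)).2, congrArg _ (h (starK k)).1⟩

theorem algebraMap (c : ℂ) :
    (algebraMap ℂ (PedersenMultiplier A) c).IsRestrictionOf (algebraMap ℂ 𝓜(ℂ, A) c) :=
  fun k => by
    rw [left_algebraMap, right_algebraMap, algebraMap_fst, algebraMap_snd]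
    simp [Algebra.algebraMap_eq_smul_one]

end IsRestrictionOf

/-- A multiplier of Pedersen's ideal that is bounded from both sides extends to `A`. -/
theorem exists_isRestrictionOf {S : PedersenMultiplier A} {M : ℝ} (hM : 0 ≤ M)
    (hl : ∀ k, ‖(S.left k : A)‖ ≤ M * ‖(k : A)‖) (hr : ∀ k, ‖(S.right k : A)‖ ≤ M * ‖(k : A)‖) :
    ∃ m : 𝓜(ℂ, A), S.IsRestrictionOf m ∧ ‖m‖ ≤ M := by
  set l : pedersenIdeal A →ₗ[ℂ] A := (pedersenIdeal A).subtype ∘ₗ S.left with hl_def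
  set r : pedersenIdeal A →ₗ[ℂ] A := (pedersenIdeal A).subtype ∘ₗ S.right with hr_def
  have hd : DenseRange (pedersenIdeal A).subtype := by
    simpa [DenseRange] using dense_pedersenIdeal (A := A)
  have hle := l.extendOfNorm_eq (e := (pedersenIdeal A).subtype) hd ⟨M, hl⟩
  have hre := r.extendOfNorm_eq (e := (pedersenIdeal A).subtype) hd ⟨M, hr⟩
  set fl := l.extendOfNorm (pedersenIdeal A).subtype with hfl
  set fr := r.extendOfNorm (pedersenIdeal A).subtype with hfr
  have hcentral : ∀ x y : A, fr x * y = x * fl y := by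
    have h1 : ∀ x ∈ pedersenIdeal A, ∀ y, fr x * y = x * fl y := by
      intro x hx y
      refine congrFun (Continuous.ext_on dense_pedersenIdeal (f := fun y => fr x * y)
        (g := fun y => x * fl y) (by fun_prop) (by fun_prop) fun k hk => ?_) y
      have h1 := hle ⟨k, hk⟩
      have h2 := hre ⟨x, hx⟩
      simp only [Submodule.subtype_apply] at h1 h2
      simp only [h1, h2]
      exact S.central ⟨x, hx⟩ ⟨k, hk⟩
    intro x y
    exact congrFun (Continuous.ext_on dense_pedersenIdeal (f := fun x => fr x * y)
        (g := fun x => x * fl y) (by fun_prop) (by fun_prop) fun k hk => h1 k hk y) x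
  let m : 𝓜(ℂ, A) := ⟨(fl, fr), hcentral⟩
  refine ⟨m, fun k => ⟨(hle k).symm, (hre k).symm⟩, ?_⟩
  rw [← norm_fst]
  exact l.opNorm_extendOfNorm_le hd hM hl

section Calculus

variable {T : PedersenMultiplier A} (hT : IsSelfAdjoint T)

/-- If `|f| ≤ M`, then `g = (M² - |f|²)^{1/2}` satisfies
`(f(T) k)⋆ (f(T) k) + (g(T) k)⋆ (g(T) k) = M² k⋆ k`, which bounds `f(T) k`. -/
theorem norm_calculus_left_le {f : C(ℝ, ℂ)} {M : ℝ} (hf : ∀ t, ‖f t‖ ≤ M)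
    (k : pedersenIdeal A) : ‖((calculus hT f).left k : A)‖ ≤ M * ‖(k : A)‖ := by
  have hM : 0 ≤ M := (norm_nonneg _).trans (hf 0)
  let g : C(ℝ, ℂ) := ⟨fun t => ((Real.sqrt (M ^ 2 - ‖f t‖ ^ 2) : ℝ) : ℂ), by fun_prop⟩
  have hfg : star f * f + star g * g = algebraMap ℂ C(ℝ, ℂ) ((M : ℂ) ^ 2) := by
    ext t
    have h1 : 0 ≤ M ^ 2 - ‖f t‖ ^ 2 := by
      have := pow_le_pow_left₀ (norm_nonneg _) (hf t) 2
      linarith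
    have h2 : star (f t) * f t = ((‖f t‖ ^ 2 : ℝ) : ℂ) := by
      rw [mul_comm, Complex.ofReal_pow]
      exact Complex.mul_conj' (f t)
    have h3 : star (g t) * g t = ((M ^ 2 - ‖f t‖ ^ 2 : ℝ) : ℂ) := by
      rw [← Real.mul_self_sqrt h1, Complex.ofReal_mul]
      congr 1
      exact Complex.conj_ofReal _
    rw [ContinuousMap.add_apply, ContinuousMap.mul_apply, ContinuousMap.mul_apply,
      ContinuousMap.star_apply, ContinuousMap.star_apply, h2, h3, algebraMap_apply,
      smul_eq_mul, mul_one]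
    push_cast
    ring
  have key : star ((calculus hT f).left k : A) * (calculus hT f).left k +
      star ((calculus hT g).left k : A) * (calculus hT g).left k =
      ((M : ℂ) ^ 2) • (star (k : A) * k) := by
    rw [star_left_mul, star_left_mul, ← mul_add, ← left_mul, ← left_mul, ← map_star, ← map_star,
      ← map_mul, ← map_mul, ← Submodule.coe_add, ← left_add, ← map_add, hfg,
      AlgHomClass.commutes, left_algebraMap, Submodule.coe_smul, mul_smul_comm]
  have h := norm_sq_le_norm_add_star_mul_self ((calculus hT f).left k : A)
    ((calculus hT g).left k : A)
  rw [key, norm_smul, CStarRing.norm_star_mul_self] at h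
  refine le_of_sq_le_sq (h.trans_eq ?_) (by positivity)
  simp [abs_of_nonneg hM]
  ring

theorem exists_calculus_isRestrictionOf {f : C(ℝ, ℂ)} {M : ℝ} (hf : ∀ t, ‖f t‖ ≤ M) :
    ∃ m : 𝓜(ℂ, A), (calculus hT f).IsRestrictionOf m ∧ ‖m‖ ≤ M := by
  refine exists_isRestrictionOf ((norm_nonneg _).trans (hf 0)) (norm_calculus_left_le hT hf)
    fun k => ?_
  have h := norm_calculus_left_le hT (f := star f) (M := M) (fun t => by
    rw [ContinuousMap.star_apply, norm_star]; exact hf t) (starK k)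
  rw [map_star, left_star, starK_starK] at h
  change ‖star ((calculus hT f).right k : A)‖ ≤ M * ‖star (k : A)‖ at h
  rwa [norm_star, norm_star] at h

open BoundedContinuousFunction

/-- The value of the bounded functional calculus at `f`, the multiplier of `A`
that extends `f(T)`. -/
noncomputable def boundedCalculusFun (f : ℝ →ᵇ ℂ) : 𝓜(ℂ, A) :=
  (exists_calculus_isRestrictionOf hT (f := f.toContinuousMap) f.norm_coe_le_norm).choose

theorem isRestrictionOf_boundedCalculusFun (f : ℝ →ᵇ ℂ) :
    (calculus hT f.toContinuousMap).IsRestrictionOf (boundedCalculusFun hT f) :=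
  (exists_calculus_isRestrictionOf hT (f := f.toContinuousMap) f.norm_coe_le_norm).choose_spec.1

theorem norm_boundedCalculusFun_le (f : ℝ →ᵇ ℂ) : ‖boundedCalculusFun hT f‖ ≤ ‖f‖ :=
  (exists_calculus_isRestrictionOf hT (f := f.toContinuousMap) f.norm_coe_le_norm).choose_spec.2

theorem boundedCalculusFun_eq {f : ℝ →ᵇ ℂ} {m : 𝓜(ℂ, A)}
    (h : (calculus hT f.toContinuousMap).IsRestrictionOf m) : boundedCalculusFun hT f = m :=
  (isRestrictionOf_boundedCalculusFun hT f).unique h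

/-- The functional calculus of a self-adjoint multiplier on bounded continuous functions, with
values in the multiplier algebra of `A`. -/
noncomputable def boundedCalculus : (ℝ →ᵇ ℂ) →⋆ₐ[ℂ] 𝓜(ℂ, A) where
  toFun := boundedCalculusFun hT
  map_one' := boundedCalculusFun_eq hT <| by
    have h := IsRestrictionOf.algebraMap (A := A) 1
    rw [map_one, map_one, ← map_one (calculus hT)] at h
    exact h
  map_zero' := boundedCalculusFun_eq hT <| by
    have h := IsRestrictionOf.algebraMap (A := A) 0
    rw [map_zero, map_zero, ← map_zero (calculus hT)] at h
    exact h
  commutes' c := boundedCalculusFun_eq hT <| by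
    have h := IsRestrictionOf.algebraMap (A := A) c
    rw [← AlgHomClass.commutes (calculus hT)] at h
    exact h
  map_add' f g := boundedCalculusFun_eq hT <| by
    have h := (isRestrictionOf_boundedCalculusFun hT f).add (isRestrictionOf_boundedCalculusFun hT g)
    rw [← map_add] at h
    exact h
  map_mul' f g := boundedCalculusFun_eq hT <| by
    have h := (isRestrictionOf_boundedCalculusFun hT f).mul (isRestrictionOf_boundedCalculusFun hT g)
    rw [← map_mul] at h
    exact h
  map_star' f := boundedCalculusFun_eq hT <| by
    have h := (isRestrictionOf_boundedCalculusFun hT f).star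
    rw [← map_star] at h
    exact h

theorem isRestrictionOf_boundedCalculus (f : ℝ →ᵇ ℂ) :
    (calculus hT f.toContinuousMap).IsRestrictionOf (boundedCalculus hT f) :=
  isRestrictionOf_boundedCalculusFun hT f

theorem norm_boundedCalculus_le (f : ℝ →ᵇ ℂ) : ‖boundedCalculus hT f‖ ≤ ‖f‖ :=
  norm_boundedCalculusFun_le hT f

theorem continuous_boundedCalculus : Continuous (boundedCalculus hT) :=
  AddMonoidHomClass.continuous_of_bound _ 1 fun f => by
    rw [one_mul]; exact norm_boundedCalculus_le hT f

theorem coe_cfc_boundedContinuousFunction {G : ℂ → ℂ} (hG : Continuous G) (f : ℝ →ᵇ ℂ) (t : ℝ) :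
    (cfc G f : ℝ →ᵇ ℂ) t = G (f t) := by
  have hf : IsStarNormal f := ⟨mul_comm _ _⟩
  let ev : (ℝ →ᵇ ℂ) →⋆ₐ[ℂ] ℂ :=
    (ContinuousMap.evalStarAlgHom ℂ ℂ t).comp (toContinuousMapStarₐ ℂ)
  have h := StarAlgHomClass.map_cfc ev G f (hG.continuousOn)
    (map_continuous ev) hf ⟨mul_comm _ _⟩
  have h2 := cfc_algebraMap (A := ℂ) (f t) G
  exact h.trans h2

theorem cfc_boundedCalculus {G : ℂ → ℂ} (hG : Continuous G) (f : ℝ →ᵇ ℂ) :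
    cfc G (boundedCalculus hT f) = boundedCalculus hT (cfc G f) := by
  have hf : IsStarNormal f := ⟨mul_comm _ _⟩
  exact (StarAlgHomClass.map_cfc (boundedCalculus hT) G f hG.continuousOn
    (continuous_boundedCalculus hT) hf (hf.map _)).symm

end Calculus

end PedersenMultiplier

/-! ### The `z`-transform -/

namespace PedersenMultiplier

open DoubleCentralizer BoundedContinuousFunction

variable {A : Type*} [NonUnitalCStarAlgebra A]

/-- The `A`-valued inner product on the graph `{((1 - z⋆z)^{1/2} a, z a)}` is `star a * b`. -/
theorem graph_inner {z : 𝓜(ℂ, A)} (hz : ‖z‖ ≤ 1) (a b : A) :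
    star ((cfc Real.sqrt (1 - star z * z)).fst a) * (cfc Real.sqrt (1 - star z * z)).fst b +
      star (z.fst a) * z.fst b = star a * b := by
  rw [star_fst_mul, star_fst_mul, (isSelfAdjoint_cfc_sqrt z).star_eq, ← mul_fst_apply,
    ← mul_fst_apply, cfc_sqrt_mul_self hz, ← mul_add, ← _root_.add_apply, ← add_fst,
    sub_add_cancel, one_fst]
  rfl

/-- A multiplier has at most one `z`-transform. If `d'`, `z'` and `d`, `z` describe the same closed
graph, then `(d' a, z' a) = (d b, z b)` defines a unitary `a ↦ b`; it maps `d' c` to `d c`, so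
`d'² = d²`, hence `d' = d`, and `d` is injective since its range contains Pedersen's ideal. -/
theorem IsZTransform.unique {T : PedersenMultiplier A} {z z' : 𝓜(ℂ, A)} (h : T.IsZTransform z)
    (h' : T.IsZTransform z') : z' = z := by
  set d := cfc Real.sqrt (1 - star z * z) with hd
  set d' := cfc Real.sqrt (1 - star z' * z') with hd'
  have hsa : star d = d := (isSelfAdjoint_cfc_sqrt z).star_eq
  have hsa' : star d' = d' := (isSelfAdjoint_cfc_sqrt z').star_eq
  have hgraph := h.2.symm.trans h'.2
  rw [← hd, ← hd'] at hgraph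
  have hto : ∀ a, ∃ b, d.fst b = d'.fst a ∧ z.fst b = z'.fst a := fun a => by
    have : (d'.fst a, z'.fst a) ∈ Set.range fun b => (d.fst b, z.fst b) := hgraph ▸ ⟨a, rfl⟩
    obtain ⟨b, hb⟩ := this
    exact ⟨b, congrArg Prod.fst hb, congrArg Prod.snd hb⟩
  have hfrom : ∀ b, ∃ a, d.fst b = d'.fst a ∧ z.fst b = z'.fst a := fun b => by
    have : (d.fst b, z.fst b) ∈ Set.range fun a => (d'.fst a, z'.fst a) := hgraph ▸ ⟨b, rfl⟩
    obtain ⟨a, ha⟩ := this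
    exact ⟨a, (congrArg Prod.fst ha).symm, (congrArg Prod.snd ha).symm⟩
  have hsq : ∀ c, d'.fst (d'.fst c) = d.fst (d.fst c) := by
    intro c
    obtain ⟨b, hb1, hb2⟩ := hto (d'.fst c)
    have hb : b = d.fst c := by
      refine eq_of_pedersenIdeal_mul_eq fun x _ => ?_
      obtain ⟨a, ha1, ha2⟩ := hfrom (star x)
      have h1 := graph_inner h.1 (star x) b
      have h2 := graph_inner h'.1 a (d'.fst c)
      rw [← hd, ha1, ha2, hb1, hb2, h2, star_star] at h1
      have h3 := star_fst_mul d' a c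
      have h4 := star_fst_mul d (star x) c
      rw [hsa'] at h3
      rw [hsa, star_star, ha1, h3, h1] at h4
      exact h4
    rw [← hb1, hb]
  have hdd : d' * d' = d * d := ext_fst fun c => by rw [mul_fst_apply, mul_fst_apply, hsq]
  rw [hd, hd', cfc_sqrt_mul_self h.1, cfc_sqrt_mul_self h'.1] at hdd
  have hd_eq : d' = d := by rw [hd, hd', hdd]
  refine ext_fst fun a => ?_
  obtain ⟨b, hb1, hb2⟩ := hto a
  have hba : b = a := by
    refine eq_of_pedersenIdeal_mul_eq fun k hk => ?_
    have hmem : (star k, (T.left ⟨star k, star_mem_pedersenIdeal hk⟩ : A)) ∈ T.closedGraph :=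
      subset_closure ⟨⟨star k, star_mem_pedersenIdeal hk⟩, rfl⟩
    rw [h.2, ← hd] at hmem
    obtain ⟨c, hc⟩ := hmem
    have hc1 : d.fst c = star k := congrArg Prod.fst hc
    rw [← star_star k, ← hc1, star_fst_mul, star_fst_mul, hsa, hb1, hd_eq]
  rw [← hb2, hba]

section ZTransform

/-- The function `t ↦ t (1 + t²)^{-1/2}` as a bounded continuous function. -/
noncomputable def zBounded : ℝ →ᵇ ℂ :=
  BoundedContinuousFunction.ofNormedAddCommGroup zFun zFun.continuous 1 fun t => by
    change ‖((t / Real.sqrt (1 + t ^ 2) : ℝ) : ℂ)‖ ≤ 1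
    rw [Complex.norm_real, norm_div, Real.norm_of_nonneg (Real.sqrt_nonneg _),
      div_le_one (by positivity), Real.norm_eq_abs]
    exact Real.abs_le_sqrt (by linarith)

theorem norm_zBounded_le : ‖zBounded‖ ≤ 1 :=
  BoundedContinuousFunction.norm_ofNormedAddCommGroup_le _ zero_le_one _

/-- The function `t ↦ (1 + t²)^{-1/4}` as a bounded continuous function. -/
noncomputable def vBounded : ℝ →ᵇ ℂ :=
  BoundedContinuousFunction.ofNormedAddCommGroup
    (fun t => (((Real.sqrt (Real.sqrt (1 + t ^ 2)))⁻¹ : ℝ) : ℂ))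
    (Complex.continuous_ofReal.comp (Continuous.inv₀ (by fun_prop) fun t => by positivity)) 1
    fun t => by
      rw [Complex.norm_real, norm_inv, Real.norm_of_nonneg (Real.sqrt_nonneg _)]
      refine inv_le_one_of_one_le₀ ?_
      rw [Real.one_le_sqrt, Real.one_le_sqrt]
      nlinarith [sq_nonneg t]

/-- The function `t ↦ (1 + t²)^{1/2}` as an element of `C(ℝ)`. -/
noncomputable def sqrtFun : C(ℝ, ℂ) := ⟨fun t => ((Real.sqrt (1 + t ^ 2) : ℝ) : ℂ), by fun_prop⟩

theorem star_vBounded_mul_self_apply (t : ℝ) :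
    (star vBounded * vBounded) t = (((Real.sqrt (1 + t ^ 2))⁻¹ : ℝ) : ℂ) := by
  have h1 : star (vBounded t) * vBounded t =
      (((Real.sqrt (Real.sqrt (1 + t ^ 2)))⁻¹ * (Real.sqrt (Real.sqrt (1 + t ^ 2)))⁻¹ : ℝ) : ℂ) := by
    rw [Complex.ofReal_mul]
    congr 1
    exact Complex.conj_ofReal _
  rw [BoundedContinuousFunction.mul_apply, BoundedContinuousFunction.star_apply, h1, ← mul_inv,
    Real.mul_self_sqrt (Real.sqrt_nonneg _)]

theorem star_zBounded : star zBounded = zBounded := by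
  ext t
  exact Complex.conj_ofReal _

theorem one_sub_star_zBounded_mul_self :
    1 - star zBounded * zBounded = (star vBounded * vBounded) * (star vBounded * vBounded) := by
  ext t
  have h1 : zBounded t = ((t / Real.sqrt (1 + t ^ 2) : ℝ) : ℂ) := rfl
  have h2 : (0 : ℝ) < 1 + t ^ 2 := by positivity
  rw [BoundedContinuousFunction.mul_apply (star vBounded * vBounded), star_vBounded_mul_self_apply,
    star_zBounded, BoundedContinuousFunction.sub_apply, BoundedContinuousFunction.mul_apply, h1,
    show (1 : ℝ →ᵇ ℂ) t = 1 from rfl]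
  norm_cast
  rw [div_mul_div_comm, ← mul_inv, Real.mul_self_sqrt h2.le]
  field_simp
  ring

theorem idFun_mul_star_vBounded_mul_self :
    idFun * (star vBounded * vBounded).toContinuousMap = zFun := by
  ext t
  rw [ContinuousMap.mul_apply]
  change (t : ℂ) * (star vBounded * vBounded) t = ((t / Real.sqrt (1 + t ^ 2) : ℝ) : ℂ)
  rw [star_vBounded_mul_self_apply, ← Complex.ofReal_mul, div_eq_mul_inv]

theorem star_vBounded_mul_self_mul_sqrtFun :
    (star vBounded * vBounded).toContinuousMap * sqrtFun = 1 := by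
  ext t
  rw [ContinuousMap.mul_apply]
  change (star vBounded * vBounded) t * ((Real.sqrt (1 + t ^ 2) : ℝ) : ℂ) = 1
  have h2 : (0 : ℝ) < 1 + t ^ 2 := by positivity
  rw [star_vBounded_mul_self_apply, ← Complex.ofReal_mul, inv_mul_cancel₀ (by positivity),
    Complex.ofReal_one]

theorem zFun_mul_sqrtFun : zFun * sqrtFun = idFun := by
  rw [← idFun_mul_star_vBounded_mul_self, mul_assoc, star_vBounded_mul_self_mul_sqrtFun, mul_one]

variable {T : PedersenMultiplier A} (hT : IsSelfAdjoint T)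

/-- The `z`-transform of a self-adjoint multiplier of Pedersen's ideal. -/
noncomputable def zTransform : 𝓜(ℂ, A) := boundedCalculus hT zBounded

theorem isRestrictionOf_zTransform : (calculus hT zFun).IsRestrictionOf (zTransform hT) :=
  isRestrictionOf_boundedCalculus hT zBounded

theorem norm_zTransform_le : ‖zTransform hT‖ ≤ 1 :=
  (norm_boundedCalculus_le hT _).trans norm_zBounded_le

theorem isSelfAdjoint_zTransform : IsSelfAdjoint (zTransform hT) := by
  rw [IsSelfAdjoint, zTransform, ← map_star, star_zBounded]

theorem cfc_sqrt_zTransform :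
    cfc Real.sqrt (1 - star (zTransform hT) * zTransform hT) =
      boundedCalculus hT (star vBounded * vBounded) := by
  rw [zTransform, ← map_star, ← map_mul, ← map_one (boundedCalculus hT), ← map_sub,
    one_sub_star_zBounded_mul_self, map_mul, map_mul, map_star, cfc_sqrt_star_mul_self_sq]

theorem isZTransform_zTransform : T.IsZTransform (zTransform hT) := by
  refine ⟨norm_zTransform_le hT, ?_⟩
  have hinner := graph_inner (norm_zTransform_le hT)
  rw [cfc_sqrt_zTransform] at hinner ⊢
  set w := boundedCalculus hT (star vBounded * vBounded)
  set z := zTransform hT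
  have hw : (calculus hT (star vBounded * vBounded).toContinuousMap).IsRestrictionOf w :=
    isRestrictionOf_boundedCalculus hT _
  have hz : (calculus hT zFun).IsRestrictionOf z := isRestrictionOf_zTransform hT
  apply Set.Subset.antisymm
  · refine closure_minimal ?_ ?_
    · rintro _ ⟨k, rfl⟩
      refine ⟨(calculus hT sqrtFun).left k, ?_⟩
      simp only [← (hw _).1, ← (hz _).1, ← left_mul, ← map_mul, star_vBounded_mul_self_mul_sqrtFun,
        zFun_mul_sqrtFun, calculus_idFun, map_one, left_one]
    · have hanti : AntilipschitzWith 2 (w.fst.prod z.fst) := by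
        refine ContinuousLinearMap.antilipschitz_of_bound _ fun a => ?_
        have h1 : ‖a‖ ^ 2 ≤ ‖w.fst a‖ ^ 2 + ‖z.fst a‖ ^ 2 := by
          rw [sq, ← CStarRing.norm_star_mul_self, ← hinner a a, sq, sq,
            ← CStarRing.norm_star_mul_self, ← CStarRing.norm_star_mul_self]
          exact norm_add_le _ _
        have h2 : ‖w.fst a‖ ≤ ‖(w.fst a, z.fst a)‖ :=
          _root_.norm_fst_le (w.fst a, z.fst a)
        have h3 : ‖z.fst a‖ ≤ ‖(w.fst a, z.fst a)‖ :=
          _root_.norm_snd_le (w.fst a, z.fst a)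
        have h4 := pow_le_pow_left₀ (norm_nonneg _) h2 2
        have h5 := pow_le_pow_left₀ (norm_nonneg _) h3 2
        change ‖a‖ ≤ 2 * ‖(w.fst a, z.fst a)‖
        refine le_of_sq_le_sq ?_ (by positivity)
        rw [mul_pow]
        linarith [sq_nonneg ‖(w.fst a, z.fst a)‖]
      exact hanti.isClosed_range (w.fst.prod z.fst).uniformContinuous
  · rintro _ ⟨a, rfl⟩
    refine map_mem_closure (f := fun a => (w.fst a, z.fst a)) (by fun_prop)
      (dense_pedersenIdeal a) fun k hk => ?_
    refine ⟨(calculus hT (star vBounded * vBounded).toContinuousMap).left ⟨k, hk⟩, ?_⟩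
    simp only [← (hw ⟨k, hk⟩).1, ← (hz ⟨k, hk⟩).1]
    rw [← idFun_mul_star_vBounded_mul_self, map_mul, left_mul, calculus_idFun]

theorem continuous_comp_re (g : C(ℝ, ℂ)) : Continuous fun w : ℂ => g w.re :=
  g.continuous.comp Complex.continuous_re

/-- Functions of the `z`-transform of `T` are functions of `T`. -/
theorem isRestrictionOf_cfcReal (g : C(ℝ, ℂ)) (f : C(ℝ, ℂ)) (hfg : ∀ t, f t = g (zFun t).re) :
    (calculus hT f).IsRestrictionOf (cfcReal g (zTransform hT)) := by
  rw [cfcReal, zTransform, cfc_boundedCalculus hT (continuous_comp_re g)]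
  have h : f = (cfc (fun w : ℂ => g w.re) zBounded : ℝ →ᵇ ℂ).toContinuousMap := by
    ext t
    rw [hfg]
    exact (coe_cfc_boundedContinuousFunction (continuous_comp_re g) zBounded t).symm
  rw [h]
  exact isRestrictionOf_boundedCalculus hT _

theorem cfcReal_mul (g h : C(ℝ, ℂ)) (z : 𝓜(ℂ, A)) :
    cfcReal (⇑g * ⇑h) z = cfcReal g z * cfcReal h z :=
  cfc_mul _ _ z (continuous_comp_re g).continuousOn (continuous_comp_re h).continuousOn

theorem exists_tsupport_subset_Icc {g : ℝ → ℂ} (hg : tsupport g ⊆ Set.Ioo (-1) 1) :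
    ∃ r : ℝ, 0 ≤ r ∧ r < 1 ∧ ∀ t, g t ≠ 0 → |t| ≤ r := by
  have hc : IsCompact (tsupport g) := (isCompact_Icc (a := (-1 : ℝ)) (b := 1)).of_isClosed_subset
    (isClosed_tsupport g) (hg.trans Set.Ioo_subset_Icc_self)
  rcases (tsupport g).eq_empty_or_nonempty with he | hne
  · refine ⟨0, le_rfl, one_pos, fun t ht => ?_⟩
    have : t ∈ tsupport g := subset_tsupport g ht
    rw [he] at this
    exact this.elim
  · obtain ⟨t₀, ht₀, hmax⟩ := hc.exists_isMaxOn hne continuous_abs.continuousOn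
    exact ⟨|t₀|, abs_nonneg _, abs_lt.mpr (hg ht₀), fun t ht => hmax (subset_tsupport g ht)⟩

/-- Each element of the span of the `f(z) a` is fixed by `h(z)` as soon as `h` is `1` on a
sufficiently large compact subinterval of `(-1, 1)`. -/
theorem exists_cfcReal_fst_eq_self {z : 𝓜(ℂ, A)} {x : A}
    (hx : x ∈ Submodule.span ℂ {x : A | ∃ f : C(ℝ, ℂ), tsupport f ⊆ Set.Ioo (-1) 1 ∧
      ∃ a : A, x = (cfcReal f z).fst a}) :
    ∃ r : ℝ, 0 ≤ r ∧ r < 1 ∧ ∀ h : C(ℝ, ℂ), (∀ t, |t| ≤ r → h t = 1) →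
      (cfcReal h z).fst x = x := by
  induction hx using Submodule.span_induction with
  | mem x hx =>
    obtain ⟨f, hf, a, rfl⟩ := hx
    obtain ⟨r, hr0, hr1, hr⟩ := exists_tsupport_subset_Icc hf
    refine ⟨r, hr0, hr1, fun h hh => ?_⟩
    have : ⇑h * ⇑f = f := by
      ext t
      rw [Pi.mul_apply]
      by_cases ht : f t = 0
      · rw [ht, mul_zero]
      · rw [hh t (hr t ht), one_mul]
    rw [← mul_fst_apply, ← cfcReal_mul, this]
  | zero => exact ⟨0, le_rfl, one_pos, fun h _ => map_zero _⟩
  | add x y _ _ hx hy =>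
    obtain ⟨r, hr0, hr1, hr⟩ := hx
    obtain ⟨s, hs0, hs1, hs⟩ := hy
    refine ⟨max r s, le_max_of_le_left hr0, max_lt hr1 hs1, fun h hh => ?_⟩
    rw [map_add, hr h fun t ht => hh t (le_max_of_le_left ht),
      hs h fun t ht => hh t (le_max_of_le_right ht)]
  | smul c x _ hx =>
    obtain ⟨r, hr0, hr1, hr⟩ := hx
    exact ⟨r, hr0, hr1, fun h hh => by rw [map_smul, hr h hh]⟩

/-- The trapezoidal function that is `1` on `[-r, r]` and vanishes outside `(-s, s)`. -/
noncomputable def trapezoid (r s : ℝ) : C(ℝ, ℂ) :=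
  ⟨fun t => ((max 0 (min 1 ((s - |t|) / (s - r))) : ℝ) : ℂ), by fun_prop⟩

theorem trapezoid_eq_one {r s t : ℝ} (h : r < s) (ht : |t| ≤ r) : trapezoid r s t = 1 := by
  change ((max 0 (min 1 ((s - |t|) / (s - r))) : ℝ) : ℂ) = 1
  have : 1 ≤ (s - |t|) / (s - r) := by rw [le_div_iff₀ (by linarith)]; linarith
  rw [min_eq_left this, max_eq_right zero_le_one, Complex.ofReal_one]

theorem trapezoid_eq_zero {r s t : ℝ} (h : r < s) (ht : s ≤ |t|) : trapezoid r s t = 0 := by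
  change ((max 0 (min 1 ((s - |t|) / (s - r))) : ℝ) : ℂ) = 0
  have : (s - |t|) / (s - r) ≤ 0 := div_nonpos_of_nonpos_of_nonneg (by linarith) (by linarith)
  rw [max_eq_left ((min_le_right _ _).trans this), Complex.ofReal_zero]

theorem hasCompactSupport_comp_zFun {s : ℝ} (hs0 : 0 ≤ s) (hs : s < 1) {f : ℝ → ℂ}
    (hf : ∀ t, s ≤ |(zFun t).re| → f t = 0) : HasCompactSupport f := by
  -- `|t| (1 + t²)^{-1/2} < s` means `t² (1 - s²) < s²`
  refine HasCompactSupport.intro (K := Set.Icc (-(1 / (1 - s ^ 2))) (1 / (1 - s ^ 2)))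
    isCompact_Icc fun t ht => hf t ?_
  by_contra! hlt
  refine ht (abs_le.mp ?_)
  have h1 : (zFun t).re = t / Real.sqrt (1 + t ^ 2) := Complex.ofReal_re _
  have h2 : (0 : ℝ) < 1 + t ^ 2 := by positivity
  rw [h1, abs_div, abs_of_nonneg (Real.sqrt_nonneg _), div_lt_iff₀ (by positivity)] at hlt
  have h3 := pow_lt_pow_left₀ hlt (abs_nonneg t) two_ne_zero
  rw [mul_pow, Real.sq_sqrt h2.le] at h3
  have h4 : 0 < 1 - s ^ 2 := by nlinarith
  rw [le_div_iff₀ h4]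
  by_contra! h5
  have h6 : 1 < |t| := by nlinarith [abs_nonneg t, sq_nonneg s]
  have h7 : |t| ^ 2 * (1 - s ^ 2) < 1 := by rw [sq_abs] at h3 ⊢; nlinarith
  nlinarith

theorem exists_norm_le_of_hasCompactSupport {f : C(ℝ, ℂ)} (hf : HasCompactSupport f) :
    ∃ M, ∀ t, ‖f t‖ ≤ M :=
  f.continuous.bounded_above_of_compact_support hf

end ZTransform

end PedersenMultiplier

open PedersenMultiplier

theorem proposition1p2 {A : Type*} [NonUnitalCStarAlgebra A]
    (T : PedersenMultiplier A) (hT : IsSelfAdjoint T) :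
    ∃ zT : 𝓜(ℂ, A),
      -- `zT` is the `z`-transform of `T`, and the only one
      (T.IsZTransform zT ∧ ∀ w : 𝓜(ℂ, A), T.IsZTransform w → w = zT) ∧
      IsSelfAdjoint zT ∧
      spectrum ℂ zT ⊆ (fun t : ℝ => (t : ℂ)) '' Set.Icc (-1) 1 ∧
      -- the functions in `C_00(-1,1)` are extended by zero to the line
      ((pedersenIdeal A : Set A) ⊆ Submodule.span ℂ
          {x : A | ∃ f : C(ℝ, ℂ), tsupport f ⊆ Set.Ioo (-1) 1 ∧
            ∃ a : A, x = (cfcReal f zT).fst a} →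
        ∃ φ : C(ℝ, ℂ) →⋆ₐ[ℂ] PedersenMultiplier A,
          Continuous φ ∧ φ idFun = T ∧
          (∀ ψ : C(ℝ, ℂ) →⋆ₐ[ℂ] PedersenMultiplier A,
            Continuous ψ → ψ idFun = T → ψ = φ) ∧
          (φ zFun).IsRestrictionOf zT ∧
          -- `φ(f) ∈ M(A)` for `f ∈ C_00(ℝ)`, and `φ(C_00(ℝ)) A ⊇ K(A)`
          (∀ f : C(ℝ, ℂ), HasCompactSupport f → ∃ m : 𝓜(ℂ, A), (φ f).IsRestrictionOf m) ∧
          ∀ x ∈ pedersenIdeal A, ∃ f : C(ℝ, ℂ), HasCompactSupport f ∧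
            ∃ m : 𝓜(ℂ, A), (φ f).IsRestrictionOf m ∧ ∃ a : A, x = m.fst a) := by
  refine ⟨zTransform hT, ⟨isZTransform_zTransform hT, fun w hw =>
    (isZTransform_zTransform hT).unique hw⟩, isSelfAdjoint_zTransform hT,
    spectrum_subset_Icc_of_isSelfAdjoint (isSelfAdjoint_zTransform hT) (norm_zTransform_le hT),
    fun hspan => ⟨calculus hT, continuous_calculus hT, calculus_idFun hT, calculus_unique hT,
      isRestrictionOf_zTransform hT, fun f hf => ?_, fun x hx => ?_⟩⟩
  · obtain ⟨M, hM⟩ := exists_norm_le_of_hasCompactSupport hf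
    obtain ⟨m, hm, -⟩ := exists_calculus_isRestrictionOf hT hM
    exact ⟨m, hm⟩
  -- `h(z) x = x` for a trapezoidal `h`, and `h(z)` extends `f(T)` with `f = h ∘ zFun`
  · obtain ⟨r, hr0, hr1, hr⟩ := exists_cfcReal_fst_eq_self (hspan hx)
    obtain ⟨s, hrs, hs1⟩ := exists_between hr1
    let f : C(ℝ, ℂ) := (trapezoid r s).comp
      ⟨fun t => (zFun t).re, Complex.continuous_re.comp zFun.continuous⟩
    refine ⟨f, hasCompactSupport_comp_zFun (hr0.trans hrs.le) hs1 fun t ht =>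
      trapezoid_eq_zero hrs ht, cfcReal (trapezoid r s) (zTransform hT),
      isRestrictionOf_cfcReal hT _ f fun t => rfl, x, ?_⟩
    exact (hr _ fun t ht => trapezoid_eq_one hrs ht).symm
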